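/- For a finite group $G$, let $G\otimes G$ be its nonabelian tensor square, i.e. the group generated by symbols $x\otimes h$ ($x,h\in G$) subject to the relations $xy\otimes h=({}^{x}y\otimes{}^{x}h)(x\otimes h)$ and $x\otimes hk=(x\otimes h)({}^{h}x\otimes{}^{h}k)$ for all $x,y,h,k\in G$, where ${}^{x}y=xyx^{-1}$. The tensor degree of $G$ is $$d^\otimes(G)=\frac{|\{(x,y)\in G\times G : x\otimes y=1\}|}{|G|^2}.$$ Let $D_{2^n}=\langle a,b\mid b^2=a^{2^{n-1}}=1,\ b^{-1}ab=a^{-1}\rangle$ be the dihedral group of order $2^n$, let $Q_{2^n}=\langle a,b\mid b^2=a^{2^{n-2}},\ b^{-1}ab=a^{-1}\rangle$ be the generalized quaternion group of order $2^n$, and for a prime $p$ let $E_1=\langle a,b,c\mid a^p=b^p=c^p=1,\ [a,c]=[b,c]=1,\ [a,b]=c\rangle$ with $[x,y]=x^{-1}y^{-1}xy$, which for odd $p$ is the extraspecial group of order $p^3$ and exponent $p$. A $p$-group $H$ is called extraspecial if $Z(H)=H'$ has order $p$ and $H/Z(H)$ is elementary abelian. Then: (i) $d^\otimes(Q_{2^n})=\dfrac{2^{n-3}+2^{n-4}+1}{2^n}$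 for all $n>3$, and $d^\otimes(Q_8)=\dfrac14$. (ii) $d^\otimes(D_{2^n})=\dfrac{2^{n-3}+2^{n-4}+1}{2^n}$ for all $n>3$, and $d^\otimes(D_8)=\dfrac5{16}$. (iii) $d^\otimes(E_1)=\dfrac{2p^2+p-2}{p^5}$ for every odd prime $p$. (iv) Let $p$ be a prime, $m\ge1$, and let $H$ be an extraspecial $p$-group of order $p^{2m+1}$ that is not isomorphic to $E_1$, $Q_8$ or $D_8$. Then $d^\otimes(H)=\dfrac{2p^{2m}-1}{p^{4m}}$. -/

import Mathlib

namespace TensorDegree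

/-- The defining relators of the nonabelian tensor square, with `G` acting on itself by the
left conjugation `ˣy = x y x⁻¹`:
`xy ⊗ h = (ˣy ⊗ ˣh) (x ⊗ h)` and `x ⊗ hk = (x ⊗ h) (ʰx ⊗ ʰk)`.
The generator `FreeGroup.of (x, h)` stands for the symbol `x ⊗ h`. -/
def tensorRels (G : Type*) [Group G] : Set (FreeGroup (G × G)) :=
  {r | ∃ x y h : G, r = FreeGroup.of (x * y, h) *
      (FreeGroup.of (x * y * x⁻¹, x * h * x⁻¹) * FreeGroup.of (x, h))⁻¹} ∪
  {r | ∃ x h k : G, r = FreeGroup.of (x, h * k) *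
      (FreeGroup.of (x, h) * FreeGroup.of (h * x * h⁻¹, h * k * h⁻¹))⁻¹}

/-- The nonabelian tensor square `G ⊗ G`. -/
abbrev TensorSquare (G : Type*) [Group G] : Type _ :=
  PresentedGroup (tensorRels G)

/-- The element `x ⊗ y` of `G ⊗ G`. -/
def tmul {G : Type*} [Group G] (x y : G) : TensorSquare G :=
  PresentedGroup.of (x, y)

/-- The tensor degree `|{(x, y) ∈ G × G : x ⊗ y = 1}| / |G|²` of a finite group `G`. -/
noncomputable def tensorDegree (G : Type*) [Group G] : ℚ :=
  (Nat.card {z : G × G // tmul z.1 z.2 = 1} : ℚ) / (Nat.card G : ℚ) ^ 2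

/-- The relators of `⟨a, b, c | aᵖ = bᵖ = cᵖ = 1, [a, c] = [b, c] = 1, [a, b] = c⟩`,
where `[x, y] = x⁻¹ y⁻¹ x y` and `a, b, c` are the generators with index `0, 1, 2`. -/
def extraspecialRels (p : ℕ) : Set (FreeGroup (Fin 3)) :=
  let a : FreeGroup (Fin 3) := FreeGroup.of 0
  let b : FreeGroup (Fin 3) := FreeGroup.of 1
  let c : FreeGroup (Fin 3) := FreeGroup.of 2
  {a ^ p, b ^ p, c ^ p, a⁻¹ * c⁻¹ * a * c, b⁻¹ * c⁻¹ * b * c, a⁻¹ * b⁻¹ * a * b * c⁻¹}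

/-- The group `E₁ = ⟨a, b, c | aᵖ = bᵖ = cᵖ = 1, [a, c] = [b, c] = 1, [a, b] = c⟩`; for an odd
prime `p` it is the extraspecial group of order `p³` and exponent `p`. -/
abbrev ExtraspecialE1 (p : ℕ) : Type :=
  PresentedGroup (extraspecialRels p)

/-- Extraspecial `p`-groups: `p`-groups `H` with `Z(H) = H'` of order `p` and with `H / Z(H)`
elementary abelian. -/
structure IsExtraspecial (p : ℕ) (H : Type*) [Group H] : Prop where
  isPGroup : IsPGroup p H
  commutator_eq_center : commutator H = Subgroup.center H
  card_center : Nat.card (Subgroup.center H) = p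
  pow_mem_center : ∀ x : H, x ^ p ∈ Subgroup.center H

end TensorDegree

namespace TensorDegree

open scoped commutatorElement

/-! ### Crossed pairings and identities in the tensor square. -/

section Basic

variable {G : Type*} [Group G]

/-! Everything rests on deciding when `x ⊗ y = 1`, after which the pairs are counted. Nontriviality
is detected by crossed pairings, i.e. homomorphisms out of `G ⊗ G`: products of two homomorphisms to
a ring (`hom_mul_hom_eq_zero`), commutators of lifts to a central extension
(`commute_lifts_of_tmul_eq_one`), and explicit "half commutators" on dihedral and quaternion groups.
Triviality comes from identities: powers pass through the tensor of commuting elements, `a ⊗ b² = (a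
⊗ a)⁻²` when `b` inverts `a`, and `[x, y] ⊗ h = (x ⊗ y) ʰ(x ⊗ y)⁻¹`.

In dihedral and quaternion groups, apart from pairs containing 1, only pairs inside the cyclic
subgroup can be trivial. There `aⁱ ⊗ aʲ = (a ⊗ a)^(ij)`, and `a ⊗ a` has order 2, except order 4 in
`Q₈`. In the Heisenberg group over a field with 2 invertible, a pair is trivial exactly when an
entry is 1 or both entries are central; a central extension of class three separates a nontrivial
central element from a noncentral one.

In an extraspecial group two noncentral elements never have trivial tensor, so the generic formula
amounts to `z ⊗ y = 1` for all central `z`. Beyond order `p³`, every centralizer contains a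
nontrivial commutator, which generates the centre. In order `p³` with `p` odd, an element of order
`p²` supplies the vanishing, and exponent `p` forces `E₁`. Order 8 leaves only excluded groups. -/

theorem tmul_mul_left (x y h : G) :
    tmul (x * y) h = tmul (x * y * x⁻¹) (x * h * x⁻¹) * tmul x h := by
  have := PresentedGroup.one_of_mem (rels := tensorRels G) (Or.inl ⟨x, y, h, rfl⟩)
  simpa [tmul, PresentedGroup.of, mul_inv_eq_one, ← mul_inv_rev] using this

theorem tmul_mul_right (x h k : G) :
    tmul x (h * k) = tmul x h * tmul (h * x * h⁻¹) (h * k * h⁻¹) := by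
  have := PresentedGroup.one_of_mem (rels := tensorRels G) (Or.inr ⟨x, h, k, rfl⟩)
  simpa [tmul, PresentedGroup.of, mul_inv_eq_one, ← mul_inv_rev] using this

/-- Crossed pairings extend to homomorphisms out of the nonabelian tensor square. -/
theorem exists_lift {L : Type*} [Group L] (f : G → G → L)
    (hl : ∀ x y h, f (x * y) h = f (x * y * x⁻¹) (x * h * x⁻¹) * f x h)
    (hr : ∀ x h k, f x (h * k) = f x h * f (h * x * h⁻¹) (h * k * h⁻¹)) :
    ∃ F : TensorSquare G →* L, ∀ x y, F (tmul x y) = f x y := by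
  have key : ∀ r ∈ tensorRels G, FreeGroup.lift (fun z : G × G => f z.1 z.2) r = 1 := by
    rintro r (⟨x, y, h, rfl⟩ | ⟨x, h, k, rfl⟩)
    · rw [map_mul, map_inv, map_mul, mul_inv_eq_one]
      simpa using hl x y h
    · rw [map_mul, map_inv, map_mul, mul_inv_eq_one]
      simpa using hr x h k
  exact ⟨PresentedGroup.toGroup key, fun x y => PresentedGroup.toGroup.of key⟩

theorem pairing_eq_one {L : Type*} [Group L] (f : G → G → L)
    (hl : ∀ x y h, f (x * y) h = f (x * y * x⁻¹) (x * h * x⁻¹) * f x h)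
    (hr : ∀ x h k, f x (h * k) = f x h * f (h * x * h⁻¹) (h * k * h⁻¹))
    {x y : G} (h : tmul x y = 1) : f x y = 1 := by
  obtain ⟨F, hF⟩ := exists_lift f hl hr
  rw [← hF, h, map_one]

/-- Additive crossed pairings vanish on pairs with trivial tensor. -/
theorem pairing_eq_zero {A : Type*} [AddCommGroup A] (f : G → G → A)
    (hl : ∀ x y h, f (x * y) h = f (x * y * x⁻¹) (x * h * x⁻¹) + f x h)
    (hr : ∀ x h k, f x (h * k) = f x h + f (h * x * h⁻¹) (h * k * h⁻¹))
    {x y : G} (h : tmul x y = 1) : f x y = 0 :=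
  congrArg Multiplicative.toAdd <|
    pairing_eq_one (L := Multiplicative A) (fun x y => Multiplicative.ofAdd (f x y))
      (fun x y h => congrArg Multiplicative.ofAdd (hl x y h))
      (fun x h k => congrArg Multiplicative.ofAdd (hr x h k)) h

/-- A product of two homomorphisms to a ring vanishes on pairs with trivial tensor. -/
theorem hom_mul_hom_eq_zero {R : Type*} [CommRing R] (f g : G →* Multiplicative R)
    {x y : G} (h : tmul x y = 1) : (f x).toAdd * (g y).toAdd = 0 := by
  refine pairing_eq_zero (fun x y => (f x).toAdd * (g y).toAdd) ?_ ?_ h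
  · intro x y h
    simp only [map_mul, map_inv, toAdd_mul, toAdd_inv]
    ring
  · intro x y h
    simp only [map_mul, map_inv, toAdd_mul, toAdd_inv]
    ring

/-- If `x ⊗ y = 1`, then lifts of `x` and `y` to a central extension commute. -/
theorem commute_lifts_of_tmul_eq_one {K : Type*} [Group K] (π : K →* G)
    (hs : Function.Surjective π) (hc : π.ker ≤ Subgroup.center K) {x y : K}
    (h : tmul (π x) (π y) = 1) : Commute x y := by
  have key : ∀ x x' y y' : K, π x = π x' → π y = π y' → ⁅x, y⁆ = ⁅x', y'⁆ := by
    intro x x' y y' hx hy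
    have h1 : x'⁻¹ * x ∈ Subgroup.center K := hc (by simp [MonoidHom.mem_ker, hx])
    have h2 : y'⁻¹ * y ∈ Subgroup.center K := hc (by simp [MonoidHom.mem_ker, hy])
    obtain ⟨z, hz, rfl⟩ : ∃ z ∈ Subgroup.center K, x = x' * z := ⟨_, h1, by group⟩
    obtain ⟨w, hw, rfl⟩ : ∃ w ∈ Subgroup.center K, y = y' * w := ⟨_, h2, by group⟩
    rw [Subgroup.mem_center_iff] at hz hw
    simp only [commutatorElement_def, mul_inv_rev]
    calc x' * z * (y' * w) * (z⁻¹ * x'⁻¹) * (w⁻¹ * y'⁻¹)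
        = x' * (z * (y' * w)) * z⁻¹ * x'⁻¹ * w⁻¹ * y'⁻¹ := by group
      _ = x' * y' * (w * x'⁻¹) * w⁻¹ * y'⁻¹ := by rw [← hz (y' * w)]; group
      _ = x' * y' * x'⁻¹ * y'⁻¹ := by rw [← hw]; group
  -- Any set-theoretic section will do: by `key` the commutator of lifts depends only on the images,
  -- which makes it a crossed pairing on `G`.
  let σ := Function.surjInv hs
  have hσ : ∀ g, π (σ g) = g := Function.surjInv_eq hs
  have h1 : ⁅σ (π x), σ (π y)⁆ = 1 := by
    refine pairing_eq_one (fun g h => ⁅σ g, σ h⁆) ?_ ?_ h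
    · intro g h k
      rw [key (σ (g * h)) (σ g * σ h) (σ k) (σ k) (by simp [hσ]) rfl,
        key (σ (g * h * g⁻¹)) (σ g * σ h * (σ g)⁻¹) (σ (g * k * g⁻¹)) (σ g * σ k * (σ g)⁻¹)
          (by simp [hσ]) (by simp [hσ])]
      simp only [commutatorElement_def]
      group
    · intro g h k
      rw [key (σ g) (σ g) (σ (h * k)) (σ h * σ k) rfl (by simp [hσ]),
        key (σ (h * g * h⁻¹)) (σ h * σ g * (σ h)⁻¹) (σ (h * k * h⁻¹)) (σ h * σ k * (σ h)⁻¹)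
          (by simp [hσ]) (by simp [hσ])]
      simp only [commutatorElement_def]
      group
  exact commutatorElement_eq_one_iff_commute.1
    ((key x (σ (π x)) y (σ (π y)) (hσ _).symm (hσ _).symm).trans h1)

@[simp]
theorem tmul_one_left (h : G) : tmul 1 h = 1 := by
  simpa using tmul_mul_left 1 1 h

@[simp]
theorem tmul_one_right (x : G) : tmul x 1 = 1 := by
  simpa using tmul_mul_right x 1 1

theorem tmul_map_eq_one {K : Type*} [Group K] (φ : G →* K) {x y : G} (h : tmul x y = 1) :
    tmul (φ x) (φ y) = 1 := by
  refine pairing_eq_one (fun x y => tmul (φ x) (φ y)) (fun x y h => ?_) (fun x h k => ?_) h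
  · simp only [map_mul, map_inv]
    exact tmul_mul_left _ _ _
  · simp only [map_mul, map_inv]
    exact tmul_mul_right _ _ _

theorem tensorDegree_congr {K : Type*} [Group K] (e : G ≃* K) :
    tensorDegree G = tensorDegree K := by
  have h1 : Nat.card {z : G × G // tmul z.1 z.2 = 1} =
      Nat.card {z : K × K // tmul z.1 z.2 = 1} := by
    refine Nat.card_congr ((e.toEquiv.prodCongr e.toEquiv).subtypeEquiv fun z => ?_)
    refine ⟨fun h => tmul_map_eq_one e.toMonoidHom h, fun h => ?_⟩
    simpa using tmul_map_eq_one e.symm.toMonoidHom h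
  rw [tensorDegree, tensorDegree, h1, Nat.card_congr e.toEquiv]

/-- The homomorphism of `G ⊗ G` sending `x ⊗ y` to `(y ⊗ x)⁻¹`. -/
theorem exists_swap : ∃ S : TensorSquare G →* TensorSquare G,
    ∀ x y, S (tmul x y) = (tmul y x)⁻¹ := by
  refine exists_lift (fun x y => (tmul y x)⁻¹) (fun x y h => ?_) (fun x h k => ?_)
  · rw [tmul_mul_right, mul_inv_rev]
  · rw [tmul_mul_left, mul_inv_rev]

theorem tmul_swap_eq_one {x y : G} (h : tmul x y = 1) : tmul y x = 1 := by
  obtain ⟨S, hS⟩ := exists_swap (G := G)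
  simpa [h] using (hS x y).symm

/-- Expand `xu ⊗ yv` first on the left and then on the right, and in the opposite order. The outcome
says that conjugation by `x ⊗ y` acts on symbols as conjugation by `[x, y]`. -/
theorem tmul_conj_mul_tmul (x y u v : G) :
    tmul (x * y * u * (x * y)⁻¹) (x * y * v * (x * y)⁻¹) * tmul x y =
      tmul x y * tmul (y * x * u * (y * x)⁻¹) (y * x * v * (y * x)⁻¹) := by
  have h1 := tmul_mul_left x u (y * v)
  have h2 := tmul_mul_right (x * u) y v
  rw [tmul_mul_right x, show x * (y * v) * x⁻¹ = (x * y * x⁻¹) * (x * v * x⁻¹) by group,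
    tmul_mul_right (x * u * x⁻¹)] at h1
  rw [tmul_mul_left x u y, show y * (x * u) * y⁻¹ = (y * x * y⁻¹) * (y * u * y⁻¹) by group,
    tmul_mul_left (y * x * y⁻¹), h1] at h2
  simp only [mul_assoc, mul_inv_rev, inv_mul_cancel_left, inv_inv] at h2 ⊢
  have h3 := mul_left_cancel h2
  simp only [← mul_assoc] at h3 ⊢
  exact mul_right_cancel h3

theorem tmul_commute_of_commute {x y : G} (h : Commute x y) (u v : G) :
    Commute (tmul x y) (tmul u v) := by
  have := tmul_conj_mul_tmul x y ((x * y)⁻¹ * u * (x * y)) ((x * y)⁻¹ * v * (x * y))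
  rw [← h.eq] at this
  have e : ∀ w : G, x * y * ((x * y)⁻¹ * w * (x * y)) * (x * y)⁻¹ = w := fun w => by group
  rw [e, e] at this
  exact this.symm

theorem tmul_pow_left {x y : G} (h : Commute x y) (n : ℕ) : tmul (x ^ n) y = tmul x y ^ n := by
  induction n with
  | zero => simp
  | succ n ih =>
    have hc : x ^ n * y * (x ^ n)⁻¹ = y := by rw [(h.pow_left n).eq]; group
    rw [pow_succ, tmul_mul_left, hc, ih, pow_succ']
    congr 2
    group

theorem tmul_pow_right {x y : G} (h : Commute x y) (n : ℕ) : tmul x (y ^ n) = tmul x y ^ n := by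
  induction n with
  | zero => simp
  | succ n ih =>
    have hc : y ^ n * x * (y ^ n)⁻¹ = x := by rw [← (h.pow_right n).eq]; group
    rw [pow_succ, tmul_mul_right, hc, ih, pow_succ]
    congr 2
    group

/-- If `b` inverts `a`, then `a ⊗ b² = (a ⊗ a)⁻²`. -/
theorem tmul_sq_of_inverts {a b : G} (h : b * a * b⁻¹ = a⁻¹) :
    tmul a (b * b) * (tmul a a * tmul a a) = 1 := by
  have hb : b * a = a⁻¹ * b := mul_inv_eq_iff_eq_mul.1 h
  have h' : b * a⁻¹ * b⁻¹ = a := by simpa [mul_assoc] using congrArg (·⁻¹) h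
  have hinv : tmul a⁻¹ a = (tmul a a)⁻¹ := by
    have := tmul_mul_left a⁻¹ a a
    simp only [inv_mul_cancel, tmul_one_left, inv_inv, one_mul] at this
    exact eq_inv_of_mul_eq_one_right this.symm
  have hq := tmul_commute_of_commute (Commute.refl a) a b
  have h2 := tmul_mul_left a⁻¹ a b
  simp only [inv_mul_cancel, tmul_one_left, inv_inv, one_mul] at h2
  -- Compare the expansions of `a ⊗ a⁻¹b` along `a · (a⁻¹ba)` and `(a⁻¹ba) · a⁻¹`, which agree
  -- because `ba = a⁻¹b`.
  have hv : tmul a (a⁻¹ * b * a) = tmul a a * tmul a b * tmul a a := by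
    have h1 := tmul_mul_right a a (a⁻¹ * b * a)
    have e : a * (a⁻¹ * b * a) = a⁻¹ * b * a * a⁻¹ := by
      rw [mul_inv_cancel_right, mul_assoc, mul_inv_cancel_left, hb]
    have e1 : a⁻¹ * b * a * a * (a⁻¹ * b * a)⁻¹ = a⁻¹ := by
      calc _ = a⁻¹ * (b * a * b⁻¹) * a := by group
        _ = a⁻¹ := by rw [h]; group
    have e2 : a⁻¹ * b * a * a⁻¹ * (a⁻¹ * b * a)⁻¹ = a := by
      calc _ = a⁻¹ * (b * a⁻¹ * b⁻¹) * a := by group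
        _ = a := by rw [h']; group
    rw [e, tmul_mul_right a (a⁻¹ * b * a), e1, e2, hinv, mul_inv_cancel_right,
      mul_inv_eq_iff_eq_mul, ← e] at h1
    rw [h1]
    congr 3
    group
  rw [tmul_mul_right, h, mul_inv_cancel_right, eq_inv_of_mul_eq_one_right h2.symm, hv]
  simp only [mul_inv_rev, mul_assoc, inv_mul_cancel_left]
  rw [← mul_assoc, ← hq.inv_left.eq]
  group

/-- `[x, y] ⊗ h = (x ⊗ y) ʰ(x ⊗ y)⁻¹`. -/
theorem tmul_commutator_left (x y h : G) :
    tmul ⁅x, y⁆ h = tmul x y * (tmul (h * x * h⁻¹) (h * y * h⁻¹))⁻¹ := by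
  have h1 := tmul_mul_left x (y * x⁻¹ * y⁻¹) h
  have h2 := tmul_mul_left (x * y * x * y⁻¹ * x⁻¹)⁻¹ (x * y * x * y⁻¹ * x⁻¹) (x * h * x⁻¹)
  have h3 := tmul_conj_mul_tmul x y ((y * x)⁻¹ * (y * x * y⁻¹) * (y * x))
    ((y * x)⁻¹ * h * (y * x))
  -- `x ⊗ hy` is expanded along both `y · (y⁻¹hy)` and `h · y`.
  have h4 := tmul_mul_right x y (y⁻¹ * h * y)
  have h5 := tmul_mul_right x h y
  rw [show y * (y⁻¹ * h * y) = h * y by group, h5,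
    mul_inv_cancel_right] at h4
  rw [show y * x * ((y * x)⁻¹ * h * (y * x)) * (y * x)⁻¹ = h by group,
    show y * x * ((y * x)⁻¹ * (y * x * y⁻¹) * (y * x)) * (y * x)⁻¹ = y * x * y⁻¹ by group, ← h4,
    show x * y * ((y * x)⁻¹ * (y * x * y⁻¹) * (y * x)) * (x * y)⁻¹ = x * y * x * y⁻¹ * x⁻¹ by
      group,
    ← eq_mul_inv_iff_mul_eq] at h3
  rw [inv_mul_cancel, tmul_one_left,
    show 1 * (x * y * x * y⁻¹ * x⁻¹)⁻¹⁻¹ = x * y * x * y⁻¹ * x⁻¹ by group,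
    show (x * y * x * y⁻¹ * x⁻¹)⁻¹ * (x * h * x⁻¹) * (x * y * x * y⁻¹ * x⁻¹)⁻¹⁻¹ =
      x * y * ((y * x)⁻¹ * h * (y * x)) * (x * y)⁻¹ by group, h3] at h2
  rw [show x * (y * x⁻¹ * y⁻¹) * x⁻¹ = (x * y * x * y⁻¹ * x⁻¹)⁻¹ by group,
    eq_inv_of_mul_eq_one_right h2.symm] at h1
  rw [commutatorElement_def, show x * y * x⁻¹ * y⁻¹ = x * (y * x⁻¹ * y⁻¹) by group, h1]
  group

end Basic

/-! ### Counting pairs by parity. -/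

theorem two_mul_card_odd {N : ℕ} [NeZero N] (hN : 2 ∣ N) :
    2 * ((Finset.univ : Finset (ZMod N)).filter fun i => ZMod.castHom hN (ZMod 2) i ≠ 0).card
      = N := by
  have h1 : ((Finset.univ : Finset (ZMod N)).filter fun i => ZMod.castHom hN (ZMod 2) i ≠ 0).card =
      ((Finset.univ : Finset (ZMod N)).filter fun i => ¬ ZMod.castHom hN (ZMod 2) i ≠ 0).card := by
    have key : ∀ t : ZMod 2, t + 1 ≠ 0 ↔ ¬ t ≠ 0 := by decide
    have key' : ∀ t : ZMod 2, t ≠ 0 ↔ ¬ t - 1 ≠ 0 := by decide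
    refine Finset.card_bij' (fun i _ => i - 1) (fun i _ => i + 1) ?_ ?_ ?_ ?_
    · intro i hi
      simpa only [Finset.mem_filter, Finset.mem_univ, true_and, map_sub, map_one, ← key'] using hi
    · intro i hi
      simpa only [Finset.mem_filter, Finset.mem_univ, true_and, map_add, map_one, key] using hi
    · simp
    · simp
  have h2 := Finset.card_filter_add_card_filter_not (s := (Finset.univ : Finset (ZMod N)))
    (fun i => ZMod.castHom hN (ZMod 2) i ≠ 0)
  rw [← h1, Finset.card_univ, ZMod.card] at h2
  omega

theorem four_mul_card_even_products {N : ℕ} [NeZero N] (hN : 2 ∣ N) :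
    4 * ((Finset.univ : Finset (ZMod N × ZMod N)).filter fun z =>
      ZMod.castHom hN (ZMod 2) z.1 * ZMod.castHom hN (ZMod 2) z.2 = 0).card = 3 * N ^ 2 := by
  set f := ZMod.castHom hN (ZMod 2)
  have h2 := Finset.card_filter_add_card_filter_not
    (s := (Finset.univ : Finset (ZMod N × ZMod N))) (fun z => f z.1 * f z.2 = 0)
  have h3 : ((Finset.univ : Finset (ZMod N × ZMod N)).filter fun z => ¬ f z.1 * f z.2 = 0) =
      ((Finset.univ : Finset (ZMod N)).filter fun i => f i ≠ 0) ×ˢ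
        ((Finset.univ : Finset (ZMod N)).filter fun i => f i ≠ 0) := by
    ext z
    simp [mul_eq_zero, not_or]
  rw [h3, Finset.card_product, Finset.card_univ, Fintype.card_prod, ZMod.card] at h2
  have h4 := two_mul_card_odd hN
  set c := ((Finset.univ : Finset (ZMod N)).filter fun i => f i ≠ 0).card
  nlinarith

/-- The number of pairs with trivial tensor in a group that is the disjoint union of two copies
of `ZMod N` on which triviality of `x ⊗ y` has the shape found in dihedral groups. -/
theorem card_trivial_pairs {G : Type*} [Group G] {N : ℕ} [NeZero N]
    (e : ZMod N ⊕ ZMod N ≃ G) (E : ZMod N × ZMod N → Prop) [DecidablePred E]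
    (h1 : ∀ i j, tmul (e (.inl i)) (e (.inl j)) = 1 ↔ E (i, j))
    (h2 : ∀ i j, tmul (e (.inl i)) (e (.inr j)) = 1 ↔ i = 0)
    (h3 : ∀ i j, tmul (e (.inr i)) (e (.inl j)) = 1 ↔ j = 0)
    (h4 : ∀ i j, tmul (e (.inr i)) (e (.inr j)) ≠ 1) :
    Nat.card {z : G × G // tmul z.1 z.2 = 1} =
      ((Finset.univ : Finset (ZMod N × ZMod N)).filter E).card + 2 * N := by
  classical
  let P : (ZMod N ⊕ ZMod N) × (ZMod N ⊕ ZMod N) → Prop := fun z => tmul (e z.1) (e z.2) = 1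
  have hP : Nat.card {z : G × G // tmul z.1 z.2 = 1} = Nat.card {z // P z} :=
    Nat.card_congr ((e.prodCongr e).subtypeEquiv fun z => Iff.rfl).symm
  rw [hP, Nat.card_eq_fintype_card, Fintype.card_subtype, Finset.card_filter,
    Fintype.sum_prod_type, Fintype.sum_sum_type]
  simp only [Fintype.sum_sum_type, P, h1, h2, h3, h4, if_false, Finset.sum_add_distrib]
  rw [Finset.card_filter, Fintype.sum_prod_type]
  simp [ZMod.card]
  ring

/-! ### Dihedral groups. -/

section Dihedral

open DihedralGroup

/-- Half of the commutator exponent. -/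
def dihedralPairing {N : ℕ} : DihedralGroup N → DihedralGroup N → ZMod N
  | r _, r _ => 0
  | r i, sr _ => i
  | sr _, r j => -j
  | sr i, sr j => j - i

/-- The commutator of `r i` with a reflection has exponent `±2i`, which misses `i = N/2`. Its half
still satisfies the crossed pairing rules and detects every nonzero `i`. -/
theorem dihedralPairing_eq_zero {N : ℕ} {x y : DihedralGroup N} (h : tmul x y = 1) :
    dihedralPairing x y = 0 := by
  refine pairing_eq_zero _ ?_ ?_ h
  · rintro (i | i) (j | j) (k | k) <;> simp [dihedralPairing] <;> ring
  · rintro (i | i) (j | j) (k | k) <;> simp [dihedralPairing] <;> ring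

/-- The rotation parity `r i, sr i ↦ i mod 2`. -/
def dihedralParity {N : ℕ} (hN : 2 ∣ N) : DihedralGroup N →* Multiplicative (ZMod 2) :=
  MonoidHom.mk' (fun x => Multiplicative.ofAdd (ZMod.castHom hN (ZMod 2)
    (match x with | r i => i | sr i => i))) <| by
    have h2 : ∀ t : ZMod 2, -t = t := by decide
    rintro (i | i) (j | j) <;>
      simp only [r_mul_r, r_mul_sr, sr_mul_r, sr_mul_sr, map_add, ← ofAdd_add,
        sub_eq_add_neg, h2, map_neg, add_comm]

/-- The sign `r i ↦ 0`, `sr i ↦ 1`. -/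
def dihedralSign {N : ℕ} : DihedralGroup N →* Multiplicative (ZMod 2) :=
  MonoidHom.mk' (fun x => Multiplicative.ofAdd
    (match x with | r _ => (0 : ZMod 2) | sr _ => 1)) <| by
    rintro (i | i) (j | j)
    exacts [rfl, rfl, rfl, congrArg Multiplicative.ofAdd (show (0 : ZMod 2) = 1 + 1 by decide)]

theorem tmul_r_r {N : ℕ} [NeZero N] (hN : 2 ∣ N) (i j : ZMod N) :
    tmul (r i) (r j) = 1 ↔
      ZMod.castHom hN (ZMod 2) i * ZMod.castHom hN (ZMod 2) j = 0 := by
  constructor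
  · intro h
    exact hom_mul_hom_eq_zero (dihedralParity hN) (dihedralParity hN) h
  · intro h
    -- A reflection inverts `r 1` and squares to 1, so `a ⊗ b² = (a ⊗ a)⁻²` has trivial left side.
    have hq : tmul (r (1 : ZMod N)) (r 1) ^ 2 = 1 := by
      have := tmul_sq_of_inverts (a := r (1 : ZMod N)) (b := sr 0) (by simp)
      rwa [sr_mul_sr, sub_zero, ← one_def, tmul_one_right, one_mul, ← sq] at this
    have hr : ∀ i : ZMod N, r i = r 1 ^ i.val := fun i => by simp
    have hi : ∀ i : ZMod N, ZMod.castHom hN (ZMod 2) i = (i.val : ZMod 2) := fun i => by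
      conv_lhs => rw [← ZMod.natCast_zmod_val i]
      exact map_natCast _ _
    rw [hr i, hr j, tmul_pow_left ((Commute.refl _).pow_right _), tmul_pow_right (Commute.refl _),
      ← pow_mul]
    rw [hi, hi, ← Nat.cast_mul, ZMod.natCast_eq_zero_iff] at h
    obtain ⟨k, hk⟩ := h
    rw [mul_comm, hk, pow_mul, hq, one_pow]

theorem card_trivial_pairs_dihedral {N : ℕ} [NeZero N] (hN : 2 ∣ N) :
    4 * Nat.card {z : DihedralGroup N × DihedralGroup N // tmul z.1 z.2 = 1} =
      3 * N ^ 2 + 8 * N := by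
  let e : ZMod N ⊕ ZMod N ≃ DihedralGroup N :=
    { toFun := Sum.elim r sr
      invFun := fun x => match x with | r i => .inl i | sr i => .inr i
      left_inv := by rintro (i | i) <;> rfl
      right_inv := by rintro (i | i) <;> rfl }
  rw [card_trivial_pairs e (fun z : ZMod N × ZMod N =>
      ZMod.castHom hN (ZMod 2) z.1 * ZMod.castHom hN (ZMod 2) z.2 = 0)
      (fun i j => tmul_r_r hN i j), mul_add, four_mul_card_even_products hN]
  · ring
  · intro i j
    refine ⟨fun h => dihedralPairing_eq_zero h, ?_⟩
    rintro rfl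
    exact tmul_one_left _
  · intro i j
    refine ⟨fun h => neg_eq_zero.1 (dihedralPairing_eq_zero h), ?_⟩
    rintro rfl
    exact tmul_one_right _
  · intro i j h
    have := hom_mul_hom_eq_zero dihedralSign dihedralSign h
    revert this
    change ¬ ((1 : ZMod 2) * 1 = 0)
    decide

theorem tensorDegree_dihedral (n : ℕ) (hn : 3 < n) :
    tensorDegree (DihedralGroup (2 ^ (n - 1))) =
      ((2 : ℚ) ^ (n - 3) + 2 ^ (n - 4) + 1) / 2 ^ n := by
  obtain ⟨k, rfl⟩ : ∃ k, n = k + 4 := ⟨n - 4, by omega⟩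
  have h := card_trivial_pairs_dihedral (N := 2 ^ (k + 3)) (dvd_pow_self 2 (by omega))
  have h' : (4 : ℚ) * (Nat.card {z : DihedralGroup (2 ^ (k + 3)) × DihedralGroup (2 ^ (k + 3)) //
      tmul z.1 z.2 = 1} : ℚ) = 3 * (2 ^ (k + 3)) ^ 2 + 8 * 2 ^ (k + 3) := by exact_mod_cast h
  rw [show k + 4 - 1 = k + 3 by omega, show k + 4 - 3 = k + 1 by omega,
    show k + 4 - 4 = k by omega]
  rw [tensorDegree, DihedralGroup.nat_card, div_eq_div_iff (by positivity) (by positivity)]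
  rw [← mul_right_inj' (four_ne_zero (α := ℚ)), ← mul_assoc, h']
  push_cast
  ring

theorem tensorDegree_dihedral_four : tensorDegree (DihedralGroup 4) = 5 / 16 := by
  have h := card_trivial_pairs_dihedral (N := 4) (by norm_num)
  rw [tensorDegree, DihedralGroup.nat_card, show Nat.card {z : DihedralGroup 4 × DihedralGroup 4 //
      tmul z.1 z.2 = 1} = 20 by omega]
  norm_num

end Dihedral

/-! ### Generalized quaternion groups. -/

section Quaternion

open QuaternionGroup

theorem inv_a {n : ℕ} (i : ZMod (2 * n)) : (a i : QuaternionGroup n)⁻¹ = a (-i) := rfl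

theorem inv_xa {n : ℕ} (i : ZMod (2 * n)) : (xa i : QuaternionGroup n)⁻¹ =
    xa ((n : ZMod (2 * n)) + i) := rfl

/-- Half of the commutator exponent, shifted by `k` on pairs of elements outside the cyclic
subgroup. -/
def quaternionPairing {k : ℕ} :
    QuaternionGroup (2 * k) → QuaternionGroup (2 * k) → ZMod (2 * (2 * k))
  | a _, a _ => 0
  | a i, xa _ => i
  | xa _, a j => -j
  | xa i, xa j => j - i + k

/-- A product of two elements outside the cyclic subgroup carries an extra `2k` in its exponent; the
shift by `k` splits this evenly between the two factors. The remaining discrepancies are multiples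
of `4k = 0`. -/
theorem quaternionPairing_eq_zero {k : ℕ} {x y : QuaternionGroup (2 * k)} (h : tmul x y = 1) :
    quaternionPairing x y = 0 := by
  have h4 : (4 : ZMod (2 * (2 * k))) * k = 0 := by
    have := ZMod.natCast_self (2 * (2 * k))
    push_cast at this
    linear_combination this
  refine pairing_eq_zero _ ?_ ?_ h
  · rintro (i | i) (j | j) (l | l) <;> simp [quaternionPairing, inv_a, inv_xa] <;>
      try first | ring1 | linear_combination h4 | linear_combination -h4
  · rintro (i | i) (j | j) (l | l) <;> simp [quaternionPairing, inv_a, inv_xa] <;>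
      try first | ring1 | linear_combination h4 | linear_combination -h4

/-- The parity `a i, xa i ↦ i mod 2`. -/
def quaternionParity {k : ℕ} : QuaternionGroup (2 * k) →* Multiplicative (ZMod 2) :=
  MonoidHom.mk' (fun x => Multiplicative.ofAdd (ZMod.castHom (Dvd.intro _ rfl) (ZMod 2)
    (match x with | a i => i | xa i => i))) <| by
    have h2 : ∀ t : ZMod 2, -t = t := by decide
    have h0 : ZMod.castHom (Dvd.intro _ rfl) (ZMod 2) ((2 * k : ℕ) : ZMod (2 * (2 * k))) = 0 := by
      rw [map_natCast, ZMod.natCast_eq_zero_iff]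
      exact Dvd.intro _ rfl
    rintro (i | i) (j | j) <;>
      simp only [a_mul_a, a_mul_xa, xa_mul_a, xa_mul_xa, map_add, ← ofAdd_add, sub_eq_add_neg,
        map_neg, h2, add_comm, h0, zero_add]

/-- The sign `a i ↦ 0`, `xa i ↦ 1`. -/
def quaternionSign {n : ℕ} : QuaternionGroup n →* Multiplicative (ZMod 2) :=
  MonoidHom.mk' (fun x => Multiplicative.ofAdd
    (match x with | a _ => (0 : ZMod 2) | xa _ => 1)) <| by
    rintro (i | i) (j | j)
    exacts [rfl, rfl, rfl, congrArg Multiplicative.ofAdd (show (0 : ZMod 2) = 1 + 1 by decide)]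

theorem tmul_a_a_pow {n : ℕ} [NeZero n] (i j : ZMod (2 * n)) :
    tmul (a i) (a j) = tmul (a (1 : ZMod (2 * n))) (a 1) ^ (i.val * j.val) := by
  have hr : ∀ i : ZMod (2 * n), a i = a 1 ^ i.val := fun i => by simp
  rw [hr i, hr j, tmul_pow_left ((Commute.refl _).pow_right _), tmul_pow_right (Commute.refl _),
      ← pow_mul, Nat.mul_comm j.val]

theorem tmul_a_one_pow {n : ℕ} [NeZero n] :
    tmul (a (1 : ZMod (2 * n))) (a 1) ^ (n + 2) = 1 := by
  have := tmul_sq_of_inverts (a := a (1 : ZMod (2 * n))) (b := xa 0) (by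
    have : (n : ZMod (2 * n)) + n = 0 := by
      rw [← two_mul]; exact_mod_cast ZMod.natCast_self (2 * n)
    simp [inv_a, inv_xa, this])
  have h2 : (xa (0 : ZMod (2 * n)) * xa 0) = a (1 : ZMod (2 * n)) ^ n := by simp
  rw [h2, tmul_pow_right (Commute.refl _)] at this
  rw [pow_add, sq, this]

/-- Both `2n` and `2(n + 2)` kill `a ⊗ a`, hence so does their difference. -/
theorem tmul_a_one_pow_four {n : ℕ} [NeZero n] :
    tmul (a (1 : ZMod (2 * n))) (a 1) ^ 4 = 1 := by
  have h1 := tmul_a_one_pow (n := n)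
  have h2 : tmul (a (1 : ZMod (2 * n))) (a 1) ^ (2 * n) = 1 := by
    rw [← tmul_pow_right (Commute.refl _)]
    simp
  have h3 : tmul (a (1 : ZMod (2 * n))) (a 1) ^ (2 * n + 4) = 1 := by
    rw [show 2 * n + 4 = (n + 2) * 2 by ring, pow_mul, h1, one_pow]
  rwa [pow_add, h2, one_mul] at h3

theorem tmul_a_a {k : ℕ} [NeZero k] (hk : 2 ∣ k) (i j : ZMod (2 * (2 * k))) :
    tmul (a i) (a j) = 1 ↔
      ZMod.castHom (Dvd.intro _ rfl) (ZMod 2) i * ZMod.castHom (Dvd.intro _ rfl) (ZMod 2) j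
        = 0 := by
  constructor
  · intro h
    exact hom_mul_hom_eq_zero quaternionParity quaternionParity h
  · intro h
    -- For even `k` the exponent `2k + 2` is 2 modulo 4.
    have hq : tmul (a (1 : ZMod (2 * (2 * k)))) (a 1) ^ 2 = 1 := by
      obtain ⟨l, rfl⟩ := hk
      have := tmul_a_one_pow (n := 2 * (2 * l))
      rwa [pow_add, show 2 * (2 * l) = 4 * l by ring, pow_mul, ← show 2 * (2 * l) = 4 * l by ring,
        tmul_a_one_pow_four, one_pow, one_mul] at this
    have hi : ∀ i : ZMod (2 * (2 * k)),
        ZMod.castHom (Dvd.intro _ rfl) (ZMod 2) i = (i.val : ZMod 2) := fun i => by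
      conv_lhs => rw [← ZMod.natCast_zmod_val i]
      exact map_natCast _ _
    rw [tmul_a_a_pow]
    rw [hi, hi, ← Nat.cast_mul, ZMod.natCast_eq_zero_iff] at h
    obtain ⟨m, hm⟩ := h
    rw [hm, pow_mul, hq, one_pow]

theorem card_trivial_pairs_quaternion {k : ℕ} [NeZero k]
    (E : ZMod (2 * (2 * k)) × ZMod (2 * (2 * k)) → Prop) [DecidablePred E]
    (hE : ∀ i j : ZMod (2 * (2 * k)), tmul (a i) (a j) = 1 ↔ E (i, j)) :
    Nat.card {z : QuaternionGroup (2 * k) × QuaternionGroup (2 * k) // tmul z.1 z.2 = 1} =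
      (Finset.univ.filter E).card + 2 * (2 * (2 * k)) := by
  let e : ZMod (2 * (2 * k)) ⊕ ZMod (2 * (2 * k)) ≃ QuaternionGroup (2 * k) :=
    { toFun := Sum.elim a xa
      invFun := fun x => match x with | a i => .inl i | xa i => .inr i
      left_inv := by rintro (i | i) <;> rfl
      right_inv := by rintro (i | i) <;> rfl }
  refine card_trivial_pairs e E hE ?_ ?_ ?_
  · intro i j
    refine ⟨fun h => quaternionPairing_eq_zero h, ?_⟩
    rintro rfl
    exact tmul_one_left _
  · intro i j
    refine ⟨fun h => neg_eq_zero.1 (quaternionPairing_eq_zero h), ?_⟩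
    rintro rfl
    exact tmul_one_right _
  · intro i j h
    have := hom_mul_hom_eq_zero quaternionSign quaternionSign h
    revert this
    change ¬ ((1 : ZMod 2) * 1 = 0)
    decide

theorem tensorDegree_quaternion (n : ℕ) (hn : 3 < n) :
    tensorDegree (QuaternionGroup (2 ^ (n - 2))) =
      ((2 : ℚ) ^ (n - 3) + 2 ^ (n - 4) + 1) / 2 ^ n := by
  obtain ⟨k, rfl⟩ : ∃ k, n = k + 4 := ⟨n - 4, by omega⟩
  rw [show k + 4 - 2 = k + 2 by omega, show k + 4 - 3 = k + 1 by omega,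
    show k + 4 - 4 = k by omega, show 2 ^ (k + 2) = 2 * 2 ^ (k + 1) by ring]
  have h := card_trivial_pairs_quaternion (k := 2 ^ (k + 1)) (fun z =>
    ZMod.castHom (Dvd.intro _ rfl) (ZMod 2) z.1 * ZMod.castHom (Dvd.intro _ rfl) (ZMod 2) z.2 = 0)
    (tmul_a_a (dvd_pow_self 2 (by omega)))
  have h2 := four_mul_card_even_products (N := 2 * (2 * 2 ^ (k + 1))) (Dvd.intro _ rfl)
  rw [tensorDegree, Nat.card_eq_fintype_card (α := QuaternionGroup _), QuaternionGroup.card, h,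
    div_eq_div_iff (by positivity) (by positivity), ← mul_right_inj' (four_ne_zero (α := ℚ)),
    ← mul_assoc, Nat.cast_add, mul_add, ← Nat.cast_ofNat, ← Nat.cast_mul 4 (Finset.card _), h2]
  push_cast
  ring

/-- The automorphism of the quaternion group of order 8 interchanging `a 1` and `xa 0`. -/
def quaternionSwap : QuaternionGroup 2 →* QuaternionGroup 2 :=
  MonoidHom.mk' (fun x => match x with
    | a i => xa 0 ^ i.val
    | xa i => a 1 * xa 0 ^ i.val) <| by
    decide

theorem tmul_a_a_two (i j : ZMod (2 * 2)) :
    tmul (a i : QuaternionGroup 2) (a j) = 1 ↔ i * j = 0 := by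
  constructor
  · intro h
    -- The pairing vanishes on the cyclic subgroup generated by `a 1`; the automorphism moves that
    -- subgroup to the one generated by `xa 0`, where it takes the value 1 on the generator paired
    -- with itself and so detects order 4.
    have h1 := quaternionPairing_eq_zero (k := 1) (tmul_map_eq_one quaternionSwap h)
    clear h
    revert i j
    decide
  · intro h
    have h1 : 4 ∣ i.val * j.val := by
      revert i j
      decide
    obtain ⟨m, hm⟩ := h1
    rw [tmul_a_a_pow, hm, pow_mul, tmul_a_one_pow_four, one_pow]

theorem tensorDegree_quaternion_two : tensorDegree (QuaternionGroup 2) = 1 / 4 := by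
  have h := card_trivial_pairs_quaternion (k := 1) (fun z => z.1 * z.2 = 0) tmul_a_a_two
  rw [show ((Finset.univ : Finset (ZMod (2 * (2 * 1)) × ZMod (2 * (2 * 1)))).filter
    fun z => z.1 * z.2 = 0).card = 8 by decide] at h
  rw [tensorDegree, Nat.card_eq_fintype_card (α := QuaternionGroup _), QuaternionGroup.card]
  erw [h]
  norm_num

end Quaternion

/-! ### The Heisenberg group and its presentation. -/

theorem card_cross {α : Type*} [DecidableEq α] {S T : Finset α} (h : S ⊆ T) :
    (S ×ˢ T ∪ T ×ˢ S).card + S.card * S.card = 2 * (S.card * T.card) := by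
  have h1 := Finset.card_union_add_card_inter (S ×ˢ T) (T ×ˢ S)
  rw [Finset.product_inter_product, Finset.inter_eq_left.2 h, Finset.inter_eq_right.2 h,
    Finset.card_product, Finset.card_product, Finset.card_product] at h1
  rw [h1]
  ring

/-- The Heisenberg group over `R`. -/
@[ext]
structure Heisenberg (R : Type*) where
  x : R
  y : R
  z : R

namespace Heisenberg

variable {R : Type*} [CommRing R]

instance : Mul (Heisenberg R) := ⟨fun u v => ⟨u.x + v.x, u.y + v.y, u.z + v.z + u.x * v.y⟩⟩

instance : One (Heisenberg R) := ⟨⟨0, 0, 0⟩⟩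

instance : Inv (Heisenberg R) := ⟨fun u => ⟨-u.x, -u.y, -u.z + u.x * u.y⟩⟩

@[simp] theorem mul_x (u v : Heisenberg R) : (u * v).x = u.x + v.x := rfl
@[simp] theorem mul_y (u v : Heisenberg R) : (u * v).y = u.y + v.y := rfl
@[simp] theorem mul_z (u v : Heisenberg R) : (u * v).z = u.z + v.z + u.x * v.y := rfl
@[simp] theorem one_x : (1 : Heisenberg R).x = 0 := rfl
@[simp] theorem one_y : (1 : Heisenberg R).y = 0 := rfl
@[simp] theorem one_z : (1 : Heisenberg R).z = 0 := rfl
@[simp] theorem inv_x (u : Heisenberg R) : (u⁻¹).x = -u.x := rfl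
@[simp] theorem inv_y (u : Heisenberg R) : (u⁻¹).y = -u.y := rfl
@[simp] theorem inv_z (u : Heisenberg R) : (u⁻¹).z = -u.z + u.x * u.y := rfl

instance : Group (Heisenberg R) :=
  Group.ofLeftAxioms (fun u v w => by ext <;> simp <;> ring) (fun u => by ext <;> simp)
    (fun u => by ext <;> simp)

/-- The underlying triple. -/
def equivProd (R : Type*) : Heisenberg R ≃ R × R × R where
  toFun u := (u.x, u.y, u.z)
  invFun t := ⟨t.1, t.2.1, t.2.2⟩
  left_inv _ := rfl
  right_inv _ := rfl

instance [Finite R] : Finite (Heisenberg R) := Finite.of_equiv _ (equivProd R).symm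

theorem natCard (R : Type*) : Nat.card (Heisenberg R) = Nat.card R ^ 3 := by
  rw [Nat.card_congr (equivProd R), Nat.card_prod, Nat.card_prod]
  ring

/-- The first coordinate as a homomorphism. -/
def xHom : Heisenberg R →* Multiplicative R := MonoidHom.mk' (fun u => .ofAdd u.x) fun _ _ => rfl

/-- The second coordinate as a homomorphism. -/
def yHom : Heisenberg R →* Multiplicative R := MonoidHom.mk' (fun u => .ofAdd u.y) fun _ _ => rfl

/-- The automorphism induced by the symplectic transformation `(x, y) ↦ (y, -x)`. -/
def rotate : Heisenberg R →* Heisenberg R :=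
  MonoidHom.mk' (fun u => ⟨u.y, -u.x, u.z - u.x * u.y⟩) fun u v => by
    ext <;> simp <;> ring

theorem pow_x_one (n : ℕ) : (⟨1, 0, 0⟩ : Heisenberg R) ^ n = ⟨n, 0, 0⟩ := by
  induction n with
  | zero => ext <;> simp
  | succ n ih => rw [pow_succ, ih]; ext <;> simp

theorem pow_y_one (n : ℕ) : (⟨0, 1, 0⟩ : Heisenberg R) ^ n = ⟨0, n, 0⟩ := by
  induction n with
  | zero => ext <;> simp
  | succ n ih => rw [pow_succ, ih]; ext <;> simp

theorem pow_z_one (n : ℕ) : (⟨0, 0, 1⟩ : Heisenberg R) ^ n = ⟨0, 0, n⟩ := by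
  induction n with
  | zero => ext <;> simp
  | succ n ih => rw [pow_succ, ih]; ext <;> simp

section OfGenerators

variable {p : ℕ} {E : Type*} [Group E]

theorem pow_val_add [NeZero p] {g : E} (hg : g ^ p = 1) (s t : ZMod p) :
    g ^ (s + t).val = g ^ s.val * g ^ t.val := by
  rw [ZMod.val_add, ← pow_eq_pow_mod _ hg, pow_add]

theorem pow_val_mul {g : E} (hg : g ^ p = 1) (s t : ZMod p) :
    g ^ (s * t).val = g ^ (s.val * t.val) := by
  rw [ZMod.val_mul, ← pow_eq_pow_mod _ hg]

theorem pow_mul_pow_eq {a b c : E} (hca : Commute c a) (hcb : Commute c b)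
    (hab : a * b = b * a * c) (i j : ℕ) : a ^ i * b ^ j = b ^ j * a ^ i * c ^ (i * j) := by
  have h1 : SemiconjBy (b ^ j) (a * c ^ j) a := by
    induction j with
    | zero => simp
    | succ j ih =>
      have h2 : SemiconjBy b (a * c) a := by rw [SemiconjBy, hab, mul_assoc]
      have h3 : SemiconjBy b (c ^ j) (c ^ j) := (hcb.pow_left j).symm
      have h4 : SemiconjBy b (a * c ^ (j + 1)) (a * c ^ j) := by
        rw [pow_succ', ← mul_assoc]
        exact h2.mul_right h3
      rw [pow_succ]
      exact ih.mul_left h4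
  have h2 := (h1.pow_right i).eq
  rw [((hca.pow_left j).symm).mul_pow, ← pow_mul, mul_comm j i, ← mul_assoc] at h2
  exact h2.symm

/-- The homomorphism from the Heisenberg group over `ZMod p` to a group generated by elements
satisfying its defining relations. -/
def ofGenerators [NeZero p] {a b c : E} (ha : a ^ p = 1) (hb : b ^ p = 1) (hc : c ^ p = 1)
    (hca : Commute c a) (hcb : Commute c b) (hab : a * b = b * a * c) :
    Heisenberg (ZMod p) →* E :=
  MonoidHom.mk' (fun u => b ^ u.y.val * a ^ u.x.val * c ^ u.z.val) <| by
    intro u v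
    simp only [mul_x, mul_y, mul_z, pow_val_add ha, pow_val_add hb, pow_val_add hc,
      pow_val_mul hc]
    -- Moving `a ^ u.x` past `b ^ v.y` creates `c ^ (u.x * v.y)`, exactly the Heisenberg cocycle;
    -- this is why the normal form puts `b` first.
    have e1 := pow_mul_pow_eq hca hcb hab u.x.val v.y.val
    have e2 : ∀ n m, Commute (c ^ n) (a ^ m) := fun n m => hca.pow_pow n m
    have e3 : ∀ n m, Commute (c ^ n) (b ^ m) := fun n m => hcb.pow_pow n m
    have e4 : ∀ n m, Commute (c ^ n) (c ^ m) := fun n m => (Commute.refl c).pow_pow n m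
    calc _ = b ^ u.y.val * (b ^ v.y.val * a ^ u.x.val * (a ^ v.x.val * (c ^ (u.z.val) *
          c ^ v.z.val * c ^ (u.x.val * v.y.val)))) := by simp only [mul_assoc]
      _ = b ^ u.y.val * (b ^ v.y.val * a ^ u.x.val * (a ^ v.x.val * (c ^ (u.x.val * v.y.val) *
          (c ^ u.z.val * c ^ v.z.val)))) := by
        rw [((e4 _ u.z.val).mul_right (e4 (u.x.val * v.y.val) v.z.val)).eq]
      _ = b ^ u.y.val * (b ^ v.y.val * a ^ u.x.val * c ^ (u.x.val * v.y.val) *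
          (a ^ v.x.val * c ^ u.z.val * c ^ v.z.val)) := by
        simp only [mul_assoc]
        rw [← mul_assoc (c ^ (u.x.val * v.y.val)) (a ^ v.x.val), (e2 _ _).eq]
        simp only [mul_assoc]
      _ = _ := by
        rw [← e1, ← (e2 u.z.val v.x.val).eq]
        simp only [mul_assoc]
        rw [← mul_assoc (c ^ u.z.val) (b ^ v.y.val), (e3 _ _).eq]
        simp only [mul_assoc]

theorem ofGenerators_apply [NeZero p] {a b c : E} (ha : a ^ p = 1) (hb : b ^ p = 1) (hc : c ^ p = 1)
    (hca : Commute c a) (hcb : Commute c b) (hab : a * b = b * a * c) (u : Heisenberg (ZMod p)) :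
    ofGenerators ha hb hc hca hcb hab u = b ^ u.y.val * a ^ u.x.val * c ^ u.z.val := rfl

end OfGenerators

end Heisenberg

open Heisenberg in
/-- The presented group is the Heisenberg group over `ZMod p`. -/
theorem nonempty_extraspecialE1_equiv (p : ℕ) (hp : 1 < p) :
    Nonempty (ExtraspecialE1 p ≃* Heisenberg (ZMod p)) := by
  have : NeZero p := ⟨by omega⟩
  have : Fact (1 < p) := ⟨hp⟩
  let gen : Fin 3 → ExtraspecialE1 p := PresentedGroup.of
  have rel : ∀ w ∈ extraspecialRels p, PresentedGroup.mk (extraspecialRels p) w = 1 :=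
    fun w hw => PresentedGroup.one_of_mem hw
  have ha : gen 0 ^ p = 1 := rel (FreeGroup.of 0 ^ p) (by simp [extraspecialRels])
  have hb : gen 1 ^ p = 1 := rel (FreeGroup.of 1 ^ p) (by simp [extraspecialRels])
  have hc : gen 2 ^ p = 1 := rel (FreeGroup.of 2 ^ p) (by simp [extraspecialRels])
  have hca : (gen 0)⁻¹ * (gen 2)⁻¹ * gen 0 * gen 2 = 1 :=
    rel ((FreeGroup.of 0)⁻¹ * (FreeGroup.of 2)⁻¹ * FreeGroup.of 0 * FreeGroup.of 2)
      (by simp [extraspecialRels])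
  have hcb : (gen 1)⁻¹ * (gen 2)⁻¹ * gen 1 * gen 2 = 1 :=
    rel ((FreeGroup.of 1)⁻¹ * (FreeGroup.of 2)⁻¹ * FreeGroup.of 1 * FreeGroup.of 2)
      (by simp [extraspecialRels])
  have hab : (gen 0)⁻¹ * (gen 1)⁻¹ * gen 0 * gen 1 * (gen 2)⁻¹ = 1 :=
    rel ((FreeGroup.of 0)⁻¹ * (FreeGroup.of 1)⁻¹ * FreeGroup.of 0 * FreeGroup.of 1 *
      (FreeGroup.of 2)⁻¹) (by simp [extraspecialRels])
  have comm : ∀ u v : ExtraspecialE1 p, u⁻¹ * v⁻¹ * u * v = 1 → Commute v u := by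
    intro u v h
    rw [← mul_inv_rev, mul_assoc, inv_mul_eq_one] at h
    exact h
  have hab' : gen 0 * gen 1 = gen 1 * gen 0 * gen 2 := by
    rw [mul_inv_eq_one] at hab
    rw [← hab]
    group
  let θ := ofGenerators ha hb hc (comm _ _ hca) (comm _ _ hcb) hab'
  let t : Fin 3 → Heisenberg (ZMod p) := ![⟨1, 0, 0⟩, ⟨0, 1, 0⟩, ⟨0, 0, 1⟩]
  have ht : ∀ w ∈ extraspecialRels p, FreeGroup.lift t w = 1 := by
    rintro w (rfl | rfl | rfl | rfl | rfl | rfl)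
    · rw [map_pow, FreeGroup.lift_apply_of]
      exact (pow_x_one p).trans (by ext <;> simp)
    · rw [map_pow, FreeGroup.lift_apply_of]
      exact (pow_y_one p).trans (by ext <;> simp)
    · rw [map_pow, FreeGroup.lift_apply_of]
      exact (pow_z_one p).trans (by ext <;> simp)
    all_goals
      simp only [map_mul, map_inv, FreeGroup.lift_apply_of]
      ext <;> simp [t]
  let τ : ExtraspecialE1 p →* Heisenberg (ZMod p) := PresentedGroup.toGroup ht
  have hτ : ∀ i, τ (gen i) = t i := fun i => PresentedGroup.toGroup.of ht
  have hinj : Function.LeftInverse τ θ := by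
    intro u
    change τ (gen 1 ^ u.y.val * gen 0 ^ u.x.val * gen 2 ^ u.z.val) = u
    rw [map_mul, map_mul, map_pow, map_pow, map_pow, hτ, hτ, hτ]
    change (⟨0, 1, 0⟩ : Heisenberg (ZMod p)) ^ u.y.val * ⟨1, 0, 0⟩ ^ u.x.val *
      ⟨0, 0, 1⟩ ^ u.z.val = u
    rw [pow_x_one, pow_y_one, pow_z_one]
    ext <;> simp
  have hsurj : Function.Surjective θ := by
    rw [← MonoidHom.range_eq_top, eq_top_iff, ← PresentedGroup.closure_range_of,
      Subgroup.closure_le]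
    rintro _ ⟨i, rfl⟩
    refine ⟨t i, ?_⟩
    fin_cases i
    · change gen 1 ^ (0 : ZMod p).val * gen 0 ^ (1 : ZMod p).val * gen 2 ^ (0 : ZMod p).val = gen 0
      simp [ZMod.val_one]
    · change gen 1 ^ (1 : ZMod p).val * gen 0 ^ (0 : ZMod p).val * gen 2 ^ (0 : ZMod p).val = gen 1
      simp [ZMod.val_one]
    · change gen 1 ^ (0 : ZMod p).val * gen 0 ^ (0 : ZMod p).val * gen 2 ^ (1 : ZMod p).val = gen 2
      simp [ZMod.val_one]
  exact ⟨(MulEquiv.ofBijective θ ⟨hinj.injective, hsurj⟩).symm⟩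

/-! ### The class-three cover and the tensor degree of `E₁`. -/

/-- A central extension of the Heisenberg group of nilpotency class three. -/
structure HeisenbergCover (R : Type*) extends Heisenberg R where
  w : R

namespace HeisenbergCover

theorem ext_proj {R : Type*} {u v : HeisenbergCover R}
    (h : u.toHeisenberg = v.toHeisenberg) (hw : u.w = v.w) :
    u = v := by
  cases u
  cases v
  cases h
  cases hw
  rfl

variable {R : Type*} [CommRing R]

instance : One (HeisenbergCover R) := ⟨⟨1, 0⟩⟩

@[simp] theorem one_toHeisenberg : (1 : HeisenbergCover R).toHeisenberg = 1 := rfl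
@[simp] theorem one_w : (1 : HeisenbergCover R).w = 0 := rfl

variable [Invertible (2 : R)]

/-- This is multiplication of the unitriangular matrices with rows `(1, x, x²/2, w)`, `(0, 1, x,
z)`, `(0, 0, 1, y)`, `(0, 0, 0, 1)`. -/
instance : Mul (HeisenbergCover R) := ⟨fun u v =>
  ⟨u.toHeisenberg * v.toHeisenberg, u.w + v.w + u.x * v.z + ⅟2 * u.x ^ 2 * v.y⟩⟩

instance : Inv (HeisenbergCover R) :=
  ⟨fun u => ⟨u.toHeisenberg⁻¹, -u.w + u.x * u.z - ⅟2 * u.x ^ 2 * u.y⟩⟩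

@[simp] theorem mul_toHeisenberg (u v : HeisenbergCover R) :
    (u * v).toHeisenberg = u.toHeisenberg * v.toHeisenberg := rfl
@[simp] theorem mul_w (u v : HeisenbergCover R) :
    (u * v).w = u.w + v.w + u.x * v.z + ⅟2 * u.x ^ 2 * v.y := rfl
@[simp] theorem inv_toHeisenberg (u : HeisenbergCover R) :
    (u⁻¹).toHeisenberg = u.toHeisenberg⁻¹ := rfl
@[simp] theorem inv_w (u : HeisenbergCover R) :
    (u⁻¹).w = -u.w + u.x * u.z - ⅟2 * u.x ^ 2 * u.y := rfl

instance : Group (HeisenbergCover R) :=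
  Group.ofLeftAxioms
    (fun u v w => by
      refine ext_proj (by simp [mul_assoc]) ?_
      simp only [mul_w, mul_toHeisenberg, Heisenberg.mul_x, Heisenberg.mul_y, Heisenberg.mul_z]
      linear_combination (u.x * v.x * w.y) * invOf_mul_self (2 : R))
    (fun u => ext_proj (by simp) (by simp))
    (fun u => ext_proj (by simp) (by simp; ring))

/-- The projection onto the Heisenberg group. -/
def proj : HeisenbergCover R →* Heisenberg R := MonoidHom.mk' toHeisenberg fun _ _ => rfl

theorem ker_proj_le_center : (proj (R := R)).ker ≤ Subgroup.center (HeisenbergCover R) := by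
  intro u hu
  have hu' : u.toHeisenberg = 1 := hu
  rw [Subgroup.mem_center_iff]
  intro v
  refine ext_proj (by simp [hu']) ?_
  simp [hu', add_comm]

end HeisenbergCover

namespace Heisenberg

/-- In the cover, the two products of the lifts differ by `u.x * c` in the coordinate `w`. The
automorphism `rotate` fixes `⟨0, 0, c⟩` and brings `u.y` into the place of `u.x`. -/
theorem mul_eq_zero_of_tmul_eq_one {R : Type*} [CommRing R] [Invertible (2 : R)]
    {c : R} {u : Heisenberg R} (h : tmul ⟨0, 0, c⟩ u = 1) : u.x * c = 0 ∧ u.y * c = 0 := by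
  have key : ∀ u : Heisenberg R, tmul ⟨0, 0, c⟩ u = 1 → u.x * c = 0 := by
    intro u h
    have h1 := commute_lifts_of_tmul_eq_one (HeisenbergCover.proj (R := R))
      (fun u => ⟨⟨u, 0⟩, rfl⟩) HeisenbergCover.ker_proj_le_center
      (x := ⟨⟨0, 0, c⟩, 0⟩) (y := ⟨u, 0⟩) h
    simpa using (congrArg HeisenbergCover.w h1.eq).symm
  refine ⟨key u h, ?_⟩
  have h2 := tmul_map_eq_one rotate h
  have e : rotate (⟨0, 0, c⟩ : Heisenberg R) = ⟨0, 0, c⟩ := by ext <;> simp [rotate]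
  rw [e] at h2
  exact key _ h2

theorem tmul_eq_one_iff {F : Type*} [Field F] [Invertible (2 : F)]
    (u v : Heisenberg F) : tmul u v = 1 ↔
      u = 1 ∨ v = 1 ∨ (u.x = 0 ∧ u.y = 0) ∧ (v.x = 0 ∧ v.y = 0) := by
  constructor
  · intro h
    have hxx : u.x * v.x = 0 := hom_mul_hom_eq_zero xHom xHom h
    have hxy : u.x * v.y = 0 := hom_mul_hom_eq_zero xHom yHom h
    have hyx : u.y * v.x = 0 := hom_mul_hom_eq_zero yHom xHom h
    have hyy : u.y * v.y = 0 := hom_mul_hom_eq_zero yHom yHom h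
    rw [mul_eq_zero] at hxx hxy hyx hyy
    by_cases hu : u.x = 0 ∧ u.y = 0
    · by_cases hv : v.x = 0 ∧ v.y = 0
      · exact .inr (.inr ⟨hu, hv⟩)
      · left
        have h1 := mul_eq_zero_of_tmul_eq_one (c := u.z) (u := v) (by
          rw [show (⟨0, 0, u.z⟩ : Heisenberg F) = u by ext <;> simp [hu]]; exact h)
        rw [mul_eq_zero, mul_eq_zero] at h1
        ext <;> simp only [hu, one_x, one_y, one_z]
        tauto
    · have hv : v.x = 0 ∧ v.y = 0 := by tauto
      right; left
      have h1 := mul_eq_zero_of_tmul_eq_one (c := v.z) (u := u) (by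
        rw [show (⟨0, 0, v.z⟩ : Heisenberg F) = v by ext <;> simp [hv]]
        exact tmul_swap_eq_one h)
      rw [mul_eq_zero, mul_eq_zero] at h1
      ext <;> simp only [hv, one_x, one_y, one_z]
      tauto
  · rintro (rfl | rfl | ⟨hu, hv⟩)
    · exact tmul_one_left _
    · exact tmul_one_right _
    -- A central `u` is a single commutator, and conjugation by the central `v` fixes both of its
    -- entries.
    · have hu' : u = ⁅(⟨1, 0, 0⟩ : Heisenberg F), ⟨0, u.z, 0⟩⁆ := by
        ext <;> simp [commutatorElement_def, hu]
      have hvc : ∀ g : Heisenberg F, v * g * v⁻¹ = g := fun g => by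
        ext <;> simp [hv]
      rw [hu', tmul_commutator_left, hvc, hvc, mul_inv_cancel]

theorem card_trivial_pairs {F : Type*} [Field F] [Finite F] [Invertible (2 : F)] :
    Nat.card {t : Heisenberg F × Heisenberg F // tmul t.1 t.2 = 1} + 2 * Nat.card F =
      2 * Nat.card F ^ 3 + Nat.card F ^ 2 := by
  classical
  have := Fintype.ofFinite (Heisenberg F)
  let Z : Finset (Heisenberg F) := Finset.univ.filter fun u => u.x = 0 ∧ u.y = 0
  have h1Z : {1} ⊆ Z := by simp [Z]
  have hZ : Z.card = Nat.card F := by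
    have := Fintype.ofFinite F
    rw [Nat.card_eq_fintype_card, ← Finset.card_univ]
    refine Finset.card_bij' (fun u _ => u.z) (fun c _ => ⟨0, 0, c⟩) (by simp) (by simp [Z]) ?_
      (by simp)
    intro u hu
    have hu' : u.x = 0 ∧ u.y = 0 := by simpa [Z] using hu
    ext <;> simp [hu']
  have e1 := card_cross (S := {(1 : Heisenberg F)}) (T := Finset.univ) (Finset.subset_univ _)
  have e2 := card_cross h1Z
  have e3 := Finset.card_union_add_card_inter
    ({(1 : Heisenberg F)} ×ˢ Finset.univ ∪ Finset.univ ×ˢ {1}) (Z ×ˢ Z)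
  have e4 : ({(1 : Heisenberg F)} ×ˢ Finset.univ ∪ Finset.univ ×ˢ {1}) ∩ Z ×ˢ Z =
      {1} ×ˢ Z ∪ Z ×ˢ {1} := by
    ext ⟨u, v⟩
    have h1 : (1 : Heisenberg F) ∈ Z := h1Z (by simp)
    simp only [Finset.mem_inter, Finset.mem_union, Finset.mem_product, Finset.mem_singleton,
      Finset.mem_univ, true_and, and_true]
    constructor
    · rintro ⟨rfl | rfl, h2, h3⟩ <;> simp [h2, h3]
    · rintro (⟨rfl, h⟩ | ⟨h, rfl⟩) <;> simp [h, h1]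
  have e5 : Nat.card {t : Heisenberg F × Heisenberg F // tmul t.1 t.2 = 1} =
      (({(1 : Heisenberg F)} ×ˢ Finset.univ ∪ Finset.univ ×ˢ {1}) ∪ Z ×ˢ Z).card := by
    rw [Nat.card_eq_fintype_card, Fintype.card_subtype]
    congr 1
    ext ⟨u, v⟩
    simp [Z, tmul_eq_one_iff, eq_comm (a := (1 : Heisenberg F))]
  rw [e4, Finset.card_product, hZ] at e3
  rw [hZ] at e2
  rw [Finset.card_univ, ← Nat.card_eq_fintype_card, natCard] at e1
  simp only [Finset.card_singleton] at e1 e2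
  rw [e5]
  nlinarith

end Heisenberg

theorem tensorDegree_extraspecialE1 (p : ℕ) (hp : p.Prime) (h2 : p ≠ 2) :
    tensorDegree (ExtraspecialE1 p) = (2 * (p : ℚ) ^ 2 + p - 2) / (p : ℚ) ^ 5 := by
  have := Fact.mk hp
  have : Invertible (2 : ZMod p) := by
    refine invertibleOfNonzero ?_
    rw [← Nat.cast_ofNat, Ne, ZMod.natCast_eq_zero_iff]
    exact fun h => h2 ((Nat.prime_dvd_prime_iff_eq hp Nat.prime_two).1 h)
  obtain ⟨e⟩ := nonempty_extraspecialE1_equiv p hp.one_lt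
  have h := Heisenberg.card_trivial_pairs (F := ZMod p)
  rw [tensorDegree_congr e, tensorDegree, Heisenberg.natCard]
  rw [Nat.card_zmod] at h ⊢
  have h' : (Nat.card {t : Heisenberg (ZMod p) × Heisenberg (ZMod p) // tmul t.1 t.2 = 1} : ℚ) =
      2 * p ^ 3 + p ^ 2 - 2 * p := by
    rw [eq_sub_iff_add_eq]
    exact_mod_cast h
  have hp0 : (p : ℚ) ≠ 0 := by exact_mod_cast hp.ne_zero
  rw [h']
  push_cast
  field_simp

theorem mul_pow_of_class_two {G : Type*} [Group G] {x y d : G} (hx : Commute d x)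
    (hy : Commute d y) (h : y * x = x * y * d) (n : ℕ) :
    (x * y) ^ n = x ^ n * y ^ n * d ^ n.choose 2 := by
  induction n with
  | zero => simp
  | succ n ih =>
    have e1 := Heisenberg.pow_mul_pow_eq hy hx h n 1
    rw [pow_one, mul_one] at e1
    have e2 : Commute (d ^ n.choose 2) (x * y) := (hx.mul_right hy).pow_left _
    have e3 : Commute (d ^ n) y := hy.pow_left _
    calc (x * y) ^ (n + 1) = x ^ n * y ^ n * d ^ n.choose 2 * (x * y) := by rw [pow_succ, ih]
      _ = x ^ n * (y ^ n * x) * y * d ^ n.choose 2 := by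
        rw [mul_assoc _ _ (x * y), e2.eq]; simp only [mul_assoc]
      _ = x ^ n * x * (y ^ n * (d ^ n * y)) * d ^ n.choose 2 := by
        rw [e1]; simp only [mul_assoc]
      _ = x ^ (n + 1) * y ^ (n + 1) * (d ^ n * d ^ n.choose 2) := by
        rw [e3.eq, pow_succ, pow_succ]; simp only [mul_assoc]
      _ = _ := by rw [← pow_add, Nat.choose_succ_succ' n 1, Nat.choose_one_right]

/-! ### Extraspecial groups: vanishing on the centre. -/

namespace IsExtraspecial

variable {p : ℕ} {H : Type*} [Group H]

theorem commutator_mem (hH : IsExtraspecial p H) (x y : H) : ⁅x, y⁆ ∈ Subgroup.center H := by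
  rw [← hH.commutator_eq_center]
  exact Subgroup.commutator_mem_commutator (Subgroup.mem_top x) (Subgroup.mem_top y)

theorem commute_of_mem_center {z : H} (hz : z ∈ Subgroup.center H) (x : H) : Commute z x :=
  (Subgroup.mem_center_iff.1 hz x).symm

theorem pow_eq_one (hH : IsExtraspecial p H) {z : H} (hz : z ∈ Subgroup.center H) : z ^ p = 1 := by
  have := pow_card_eq_one' (x := (⟨z, hz⟩ : Subgroup.center H))
  rw [hH.card_center] at this
  simpa using congrArg Subtype.val this

theorem exists_pow_eq (hp : p.Prime) (hH : IsExtraspecial p H) {c z : H}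
    (hc : c ∈ Subgroup.center H) (hc1 : c ≠ 1) (hz : z ∈ Subgroup.center H) :
    ∃ n : ℕ, c ^ n = z := by
  have := Fact.mk hp
  have h := mem_powers_of_prime_card (g := (⟨c, hc⟩ : Subgroup.center H)) (g' := ⟨z, hz⟩)
    hH.card_center (by simpa [Subtype.ext_iff] using hc1)
  obtain ⟨n, hn⟩ := h
  exact ⟨n, by simpa using congrArg Subtype.val hn⟩

theorem exists_not_commute_of_notMem {x : H} (hx : x ∉ Subgroup.center H) :
    ∃ y, ¬ Commute x y := by
  rw [Subgroup.mem_center_iff] at hx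
  push Not at hx
  obtain ⟨y, hy⟩ := hx
  exact ⟨y, fun h => hy h.eq.symm⟩

theorem exists_not_commute (hp : p.Prime) (hH : IsExtraspecial p H) : ∃ x y : H, ¬ Commute x y := by
  by_contra! h
  have h1 : commutator H = ⊥ := by
    rw [commutator_def, Subgroup.commutator_eq_bot_iff_le_centralizer]
    intro x _
    rw [Subgroup.mem_centralizer_iff]
    exact fun y _ => h y x
  have h2 := hH.card_center
  rw [← hH.commutator_eq_center, h1, Subgroup.card_bot] at h2
  exact hp.one_lt.ne h2

theorem commutator_mul_left (hH : IsExtraspecial p H) (x y u : H) :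
    ⁅x * y, u⁆ = ⁅x, u⁆ * ⁅y, u⁆ := by
  have h := (commute_of_mem_center (hH.commutator_mem y u) x).eq
  calc ⁅x * y, u⁆ = x * ⁅y, u⁆ * u * x⁻¹ * u⁻¹ := by simp only [commutatorElement_def]; group
    _ = ⁅y, u⁆ * ⁅x, u⁆ := by rw [← h]; simp only [commutatorElement_def]; group
    _ = _ := (commute_of_mem_center (hH.commutator_mem y u) _).eq

/-- Commutation with a fixed element, as a homomorphism to `ZMod p`. -/
theorem exists_commutator_hom (hp : p.Prime) (hH : IsExtraspecial p H) (u : H) :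
    ∃ f : H →* Multiplicative (ZMod p), ∀ x, (f x).toAdd = 0 ↔ Commute x u := by
  have := Fact.mk hp
  have e : Subgroup.center H ≃* Multiplicative (ZMod p) :=
    mulEquivOfPrimeCardEq (p := p) hH.card_center (by simp)
  let f : H →* Subgroup.center H := MonoidHom.mk' (fun x => ⟨⁅x, u⁆, hH.commutator_mem x u⟩)
    fun x y => Subtype.ext (hH.commutator_mul_left x y u)
  refine ⟨e.toMonoidHom.comp f, fun x => ?_⟩
  rw [toAdd_eq_zero]
  change e (f x) = 1 ↔ _
  rw [map_eq_one_iff e e.injective, ← commutatorElement_eq_one_iff_commute]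
  exact Subtype.ext_iff

/-- For noncentral `x` and `y`, commutation with suitable elements gives homomorphisms to the field
`ZMod p` that are nonzero at `x` and at `y`; so is their product. -/
theorem mem_center_of_tmul_eq_one (hp : p.Prime) (hH : IsExtraspecial p H) {x y : H}
    (h : tmul x y = 1) : x ∈ Subgroup.center H ∨ y ∈ Subgroup.center H := by
  have := Fact.mk hp
  by_contra! hxy
  obtain ⟨u, hu⟩ := exists_not_commute_of_notMem hxy.1
  obtain ⟨v, hv⟩ := exists_not_commute_of_notMem hxy.2
  obtain ⟨f, hf⟩ := hH.exists_commutator_hom hp u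
  obtain ⟨g, hg⟩ := hH.exists_commutator_hom hp v
  rcases mul_eq_zero.1 (hom_mul_hom_eq_zero f g h) with h0 | h0
  · exact hu ((hf x).1 h0)
  · exact hv ((hg y).1 h0)

theorem tensorDegree_eq (hp : p.Prime) (hH : IsExtraspecial p H) {m : ℕ}
    (hcard : Nat.card H = p ^ (2 * m + 1))
    (hZ : ∀ z ∈ Subgroup.center H, ∀ y, tmul z y = 1) :
    tensorDegree H = (2 * (p : ℚ) ^ (2 * m) - 1) / (p : ℚ) ^ (4 * m) := by
  classical
  have : Finite H := Nat.finite_of_card_ne_zero (by rw [hcard]; exact pow_ne_zero _ hp.ne_zero)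
  have := Fintype.ofFinite H
  let Z : Finset H := Finset.univ.filter (· ∈ Subgroup.center H)
  have hZc : Z.card = p := by
    rw [← hH.card_center, Nat.card_eq_fintype_card, Fintype.card_subtype]
  have e1 := card_cross (S := Z) (Finset.subset_univ _)
  have e2 : Nat.card {z : H × H // tmul z.1 z.2 = 1} =
      (Z ×ˢ Finset.univ ∪ Finset.univ ×ˢ Z).card := by
    rw [Nat.card_eq_fintype_card, Fintype.card_subtype]
    congr 1
    ext ⟨x, y⟩
    simp only [Finset.mem_filter, Finset.mem_univ, true_and, Finset.mem_union,
      Finset.mem_product, and_true, Z]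
    refine ⟨hH.mem_center_of_tmul_eq_one hp, ?_⟩
    rintro (h | h)
    · exact hZ x h y
    · exact tmul_swap_eq_one (hZ y h x)
  rw [← e2, hZc, Finset.card_univ, ← Nat.card_eq_fintype_card, hcard] at e1
  have e3 : (Nat.card {z : H × H // tmul z.1 z.2 = 1} : ℚ) = 2 * (p * p ^ (2 * m + 1)) - p * p := by
    rw [eq_sub_iff_add_eq]
    exact_mod_cast e1
  have hp0 : (p : ℚ) ≠ 0 := by exact_mod_cast hp.ne_zero
  rw [tensorDegree, e3, hcard, Nat.cast_pow,
    div_eq_div_iff (pow_ne_zero _ (pow_ne_zero _ hp0)) (pow_ne_zero _ hp0)]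
  ring

theorem tmul_eq_one_of_exists (hp : p.Prime) (hH : IsExtraspecial p H) {c h : H}
    (hc : c ∈ Subgroup.center H) (hc1 : c ≠ 1) (hch : tmul c h = 1) :
    ∀ z ∈ Subgroup.center H, tmul z h = 1 := by
  intro z hz
  obtain ⟨n, rfl⟩ := hH.exists_pow_eq hp hc hc1 hz
  rw [tmul_pow_left (commute_of_mem_center hc h), hch, one_pow]

/-- If a noncentral `h` had abelian centralizer `C`, pick `t` outside `C`. Then `H = C⟨t⟩`, so
whatever commutes with `h` and `t` is central. That subgroup has index at most `p²`, whence `|H| ≤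
p³`. -/
theorem exists_not_commute_in_centralizer (hp : p.Prime) (hH : IsExtraspecial p H)
    (hcard : p ^ 3 < Nat.card H) (h : H) :
    ∃ x y : H, Commute x h ∧ Commute y h ∧ ¬ Commute x y := by
  by_cases hh : h ∈ Subgroup.center H
  · obtain ⟨x, y, hxy⟩ := hH.exists_not_commute hp
    exact ⟨x, y, (commute_of_mem_center hh x).symm, (commute_of_mem_center hh y).symm, hxy⟩
  by_contra! hab
  have := Fact.mk hp
  obtain ⟨t, ht⟩ := exists_not_commute_of_notMem hh
  obtain ⟨f, hf⟩ := hH.exists_commutator_hom hp h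
  obtain ⟨g, hg⟩ := hH.exists_commutator_hom hp t
  have hft : (f t).toAdd ≠ 0 := fun h0 => ht ((hf t).1 h0).symm
  have hker : (f.prod g).ker ≤ Subgroup.center H := by
    intro x hx
    rw [MonoidHom.mem_ker, MonoidHom.prod_apply, Prod.mk_eq_one] at hx
    have hxh : Commute x h := (hf x).1 (by simp [hx.1])
    have hxt : Commute x t := (hg x).1 (by simp [hx.2])
    rw [Subgroup.mem_center_iff]
    intro y
    -- Chosen so that `y t⁻ᵏ` commutes with `h`.
    set k : ℕ := ((f y).toAdd / (f t).toAdd).val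
    have hy : Commute (y * (t ^ k)⁻¹) h := by
      rw [← hf]
      simp only [map_mul, map_inv, map_pow, toAdd_mul, toAdd_inv, toAdd_pow, nsmul_eq_mul, k,
        ZMod.natCast_zmod_val]
      field_simp
      ring
    have h1 : Commute x (y * (t ^ k)⁻¹ * t ^ k) :=
      (hab x (y * (t ^ k)⁻¹) hxh hy).mul_right (hxt.pow_right k)
    rw [inv_mul_cancel_right] at h1
    exact h1.eq.symm
  have : Finite H := Nat.finite_of_card_ne_zero (by omega)
  have h1 := (f.prod g).ker.card_mul_index
  have h2 : Nat.card (f.prod g).ker ≤ p :=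
    (Subgroup.card_le_of_le hker).trans_eq hH.card_center
  have h3 : (f.prod g).ker.index ≤ p * p := by
    rw [Subgroup.index_ker]
    refine (Nat.card_le_card_of_injective _ Subtype.val_injective).trans ?_
    simp
  have h4 := Nat.mul_le_mul h2 h3
  rw [h1] at h4
  have : p * (p * p) = p ^ 3 := by ring
  omega

theorem tmul_center_of_lt_card (hp : p.Prime) (hH : IsExtraspecial p H)
    (hcard : p ^ 3 < Nat.card H) : ∀ z ∈ Subgroup.center H, ∀ y, tmul z y = 1 := by
  intro z hz h
  obtain ⟨x, y, hx, hy, hxy⟩ := hH.exists_not_commute_in_centralizer hp hcard h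
  refine hH.tmul_eq_one_of_exists hp (hH.commutator_mem x y)
    (fun h0 => hxy (commutatorElement_eq_one_iff_commute.1 h0)) ?_ z hz
  rw [tmul_commutator_left, ← hx.eq, ← hy.eq, mul_inv_cancel_right, mul_inv_cancel_right,
    mul_inv_cancel]

/-- Conjugation by `x ⊗ y` acts through `[x, y]`, which is central, hence acts trivially. -/
theorem tmul_commute (hH : IsExtraspecial p H) (x y u v : H) :
    Commute (tmul x y) (tmul u v) := by
  have h := tmul_conj_mul_tmul x y ((x * y)⁻¹ * u * (x * y)) ((x * y)⁻¹ * v * (x * y))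
  have e : ∀ w : H, x * y * ((x * y)⁻¹ * w * (x * y)) * (x * y)⁻¹ = w := fun w => by group
  have e' : ∀ w : H, y * x * ((x * y)⁻¹ * w * (x * y)) * (y * x)⁻¹ = w := fun w => by
    have := (commute_of_mem_center (hH.commutator_mem y x) w).eq
    calc _ = ⁅y, x⁆ * w * ⁅y, x⁆⁻¹ := by simp only [commutatorElement_def]; group
      _ = w := by rw [this]; group
  rw [e, e, e', e'] at h
  exact h.symm

/-- Conjugating `y` by `gⁿ` multiplies it by `[g, y]ⁿ`, so the step from `n` to `n + 1` contributes
`(g ⊗ [g, y])ⁿ`; these exponents add up to a binomial coefficient. -/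
theorem tmul_pow_left_eq (hH : IsExtraspecial p H) (g y : H) (n : ℕ) :
    tmul (g ^ n) y = tmul g ⁅g, y⁆ ^ n.choose 2 * tmul g y ^ n := by
  have hw := fun x => commute_of_mem_center (hH.commutator_mem g y) x
  have hconj : ∀ n : ℕ, g ^ n * y * (g ^ n)⁻¹ = ⁅g, y⁆ ^ n * y := by
    intro n
    induction n with
    | zero => simp
    | succ n ih =>
      calc _ = g * (g ^ n * y * (g ^ n)⁻¹) * g⁻¹ := by rw [pow_succ']; group
        _ = ⁅g, y⁆ ^ n * (g * y * g⁻¹) := by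
          rw [ih, ← mul_assoc, ← ((hw g).pow_left n).eq]; group
        _ = _ := by rw [pow_succ]; simp only [commutatorElement_def]; group
  induction n with
  | zero => simp
  | succ n ih =>
    have h1 : tmul g (⁅g, y⁆ ^ n * y) = tmul g ⁅g, y⁆ ^ n * tmul g y := by
      rw [tmul_mul_right, tmul_pow_right (hw g).symm, ((hw g).pow_left n).eq,
        ((hw y).pow_left n).eq, mul_inv_cancel_right, mul_inv_cancel_right]
    rw [pow_succ, tmul_mul_left, hconj, ← pow_succ, pow_succ', mul_inv_cancel_right, h1, ih,
      mul_assoc, ← mul_assoc (tmul g y), ((hH.tmul_commute g y g ⁅g, y⁆).pow_right _).eq,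
      mul_assoc, ← pow_succ', ← mul_assoc, ← pow_add, Nat.choose_succ_succ' n 1,
      Nat.choose_one_right]

theorem dvd_choose_two (hp : p.Prime) (h2 : p ≠ 2) : p ∣ p.choose 2 :=
  hp.dvd_choose_self two_ne_zero (lt_of_le_of_ne hp.two_le h2.symm)

theorem tmul_pow_prime_left (hp : p.Prime) (h2 : p ≠ 2) (hH : IsExtraspecial p H) (g y : H) :
    tmul (g ^ p) y = tmul g y ^ p := by
  have hw := commute_of_mem_center (hH.commutator_mem g y) g
  obtain ⟨k, hk⟩ := dvd_choose_two hp h2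
  rw [hH.tmul_pow_left_eq, hk, pow_mul, ← tmul_pow_right hw.symm,
    hH.pow_eq_one (hH.commutator_mem g y), tmul_one_right, one_pow, one_mul]

theorem tmul_pow_prime_right (hp : p.Prime) (h2 : p ≠ 2) (hH : IsExtraspecial p H) (g y : H) :
    tmul g (y ^ p) = tmul g y ^ p := by
  obtain ⟨S, hS⟩ := exists_swap (G := H)
  have h := congrArg S (hH.tmul_pow_prime_left hp h2 y g)
  rwa [map_pow, hS, hS, inv_pow, inv_inj] at h

/-- The centre is generated by `gᵖ`. Since `gᵖ ⊗ y = g ⊗ yᵖ`, it kills every `y` with `yᵖ = 1`; it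
also kills `g`, and every element is a power of `g` times such a `y`. -/
theorem tmul_center_of_pow_ne_one (hp : p.Prime) (h2 : p ≠ 2) (hH : IsExtraspecial p H) {g : H}
    (hg : g ^ p ≠ 1) : ∀ z ∈ Subgroup.center H, ∀ y, tmul z y = 1 := by
  have hz := hH.pow_mem_center g
  have hzc := commute_of_mem_center hz
  have h1 : ∀ y : H, y ^ p = 1 → tmul (g ^ p) y = 1 := by
    intro y hy
    rw [hH.tmul_pow_prime_left hp h2, ← hH.tmul_pow_prime_right hp h2, hy, tmul_one_right]
  have hgg : tmul (g ^ p) g = 1 := by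
    obtain ⟨y, hy⟩ := exists_not_commute_of_notMem (x := g) fun h => hg (hH.pow_eq_one h)
    have hw := commute_of_mem_center (hH.commutator_mem g y)
    obtain ⟨k, hk⟩ := hH.exists_pow_eq hp (hH.commutator_mem g y)
      (fun h0 => hy (commutatorElement_eq_one_iff_commute.1 h0)) hz
    have e1 : tmul ⁅g, y⁆ g = (tmul g ⁅g, y⁆)⁻¹ := by
      rw [tmul_commutator_left, mul_inv_cancel_right,
        show g * y * g⁻¹ = ⁅g, y⁆ * y by simp [commutatorElement_def], tmul_mul_right,
        (hw g).eq, (hw y).eq, mul_inv_cancel_right, mul_inv_cancel_right]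
      group
    -- Moving the exponent gives `gᵖ ⊗ g = g ⊗ gᵖ`, while writing `gᵖ` as a power of `[g, y]` makes
    -- the two mutually inverse. The order then divides both 2 and the odd prime `p`.
    have e2 : tmul (g ^ p) g = (tmul (g ^ p) g)⁻¹ := by
      conv_rhs => rw [hH.tmul_pow_prime_left hp h2, ← hH.tmul_pow_prime_right hp h2]
      rw [← hk, tmul_pow_left (hw g), tmul_pow_right (hw g).symm, e1, inv_pow]
    have e3 : tmul (g ^ p) g ^ 2 = 1 := by
      rw [sq]
      nth_rw 1 [e2]
      exact inv_mul_cancel _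
    have e4 : tmul (g ^ p) g ^ p = 1 := by
      rw [← tmul_pow_left (hzc g), hH.pow_eq_one hz, tmul_one_left]
    have hcop : Nat.Coprime 2 p := (Nat.coprime_primes Nat.prime_two hp).2 h2.symm
    have := Nat.dvd_gcd (orderOf_dvd_of_pow_eq_one e3) (orderOf_dvd_of_pow_eq_one e4)
    rwa [hcop, Nat.dvd_one, orderOf_eq_one_iff] at this
  intro z hz' y
  refine hH.tmul_eq_one_of_exists hp hz hg ?_ z hz'
  -- With `(gᵖ)ⁱ = yᵖ`, the element `g⁻ⁱy` has trivial `p`-th power, the class-two correction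
  -- vanishing because `p ∣ p.choose 2`.
  obtain ⟨i, hi⟩ := hH.exists_pow_eq hp hz hg (hH.pow_mem_center y)
  have hy' : ((g ^ i)⁻¹ * y) ^ p = 1 := by
    have hd := commute_of_mem_center (hH.commutator_mem y⁻¹ (g ^ i))
    have h3 := mul_pow_of_class_two (x := (g ^ i)⁻¹) (y := y) (hd _) (hd _)
      (by simp only [commutatorElement_def]; group) p
    obtain ⟨k, hk⟩ := dvd_choose_two hp h2
    rw [h3, hk, pow_mul, hH.pow_eq_one (hH.commutator_mem _ _), one_pow, mul_one, inv_pow,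
      ← pow_mul, mul_comm i, pow_mul, hi, inv_mul_cancel]
  have e : tmul (g ^ p) (g ^ i * ((g ^ i)⁻¹ * y)) = 1 := by
    rw [tmul_mul_right, tmul_pow_right (hzc g), hgg, one_pow, one_mul, ← (hzc (g ^ i)).eq,
      mul_inv_cancel_right]
    refine h1 _ ?_
    rw [conj_pow, hy', mul_one, mul_inv_cancel]
  rwa [mul_inv_cancel_left] at e

/-! ### Recognizing the exceptional groups of order `p³`. -/

open Heisenberg in
/-- An extraspecial group of order `p³` generated by two elements of order `p` is a Heisenberg
group. -/
theorem nonempty_equiv_heisenberg (hp : p.Prime) (hH : IsExtraspecial p H)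
    (hcard : Nat.card H = p ^ 3) {a b : H} (ha : a ^ p = 1) (hb : b ^ p = 1)
    (hab : ¬ Commute a b) : Nonempty (H ≃* Heisenberg (ZMod p)) := by
  have : NeZero p := ⟨hp.ne_zero⟩
  have hcm := hH.commutator_mem a⁻¹ b⁻¹
  set c := ⁅a⁻¹, b⁻¹⁆ with hcdef
  have hc := commute_of_mem_center hcm
  have habc : a * b = b * a * c := by rw [hcdef, commutatorElement_def]; group
  have hc1 : c ≠ 1 := fun h => hab (by rwa [h, mul_one] at habc)
  have hcp := hH.pow_eq_one hcm
  let θ := ofGenerators ha hb hcp (hc a) (hc b) habc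
  have hz : ∀ s : ZMod p, θ ⟨0, 0, s⟩ = 1 → s = 0 := by
    intro s hs
    have hs' : c ^ s.val = 1 := by simpa [θ, ofGenerators_apply] using hs
    have := orderOf_dvd_of_pow_eq_one hs'
    rw [(orderOf_eq_prime_iff (hp := ⟨hp⟩)).2 ⟨hcp, hc1⟩] at this
    exact (ZMod.val_eq_zero s).1 (Nat.eq_zero_of_dvd_of_lt this (ZMod.val_lt s))
  have hinj : Function.Injective θ := by
    rw [injective_iff_map_eq_one]
    intro u hu
    have hx : u.x = 0 := by
      refine hz _ ?_
      -- Commutators of a kernel element with the two generators push its coordinates into the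
      -- centre, where `θ` is already injective.
      rw [show (⟨0, 0, u.x⟩ : Heisenberg (ZMod p)) = u * ⟨0, 1, 0⟩ * u⁻¹ * ⟨0, 1, 0⟩⁻¹ by
        ext <;> simp; ring]
      simp [hu]
    have hy : u.y = 0 := by
      refine hz _ ?_
      rw [show (⟨0, 0, u.y⟩ : Heisenberg (ZMod p)) = ⟨1, 0, 0⟩ * u * ⟨1, 0, 0⟩⁻¹ * u⁻¹ by
        ext <;> simp; ring]
      simp [hu]
    have hz' : u.z = 0 := by
      refine hz _ ?_
      rwa [show (⟨0, 0, u.z⟩ : Heisenberg (ZMod p)) = u by ext <;> simp [hx, hy]]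
    ext <;> simp [hx, hy, hz']
  have : Finite H := Nat.finite_of_card_ne_zero (by rw [hcard]; exact pow_ne_zero _ hp.ne_zero)
  have hbij : Function.Bijective θ :=
    (Nat.bijective_iff_injective_and_card θ).2 ⟨hinj, by rw [natCard, hcard, Nat.card_zmod]⟩
  exact ⟨(MulEquiv.ofBijective θ hbij).symm⟩

theorem nonempty_equiv_extraspecialE1 (hp : p.Prime) (hH : IsExtraspecial p H)
    (hcard : Nat.card H = p ^ 3) {a b : H} (ha : a ^ p = 1) (hb : b ^ p = 1)
    (hab : ¬ Commute a b) : Nonempty (H ≃* ExtraspecialE1 p) := by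
  obtain ⟨e⟩ := hH.nonempty_equiv_heisenberg hp hcard ha hb hab
  obtain ⟨e'⟩ := nonempty_extraspecialE1_equiv p hp.one_lt
  exact ⟨e.trans e'.symm⟩

open QuaternionGroup in
/-- The quaternion group of order 8 is characterized by its usual relations. -/
theorem nonempty_equiv_quaternion {H : Type*} [Group H] (hcard : Nat.card H = 8) {g b : H}
    (hg : orderOf g = 4) (hb : b * b = g ^ 2) (hgb : g * b = b * g⁻¹) (hne : g ≠ g⁻¹) :
    Nonempty (H ≃* QuaternionGroup 2) := by
  have hg4 : g ^ 4 = 1 := hg ▸ pow_orderOf_eq_one g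
  let e : ZMod (2 * 2) → H := fun i => g ^ i.val
  have hadd : ∀ i j, e (i + j) = e i * e j := Heisenberg.pow_val_add (p := 2 * 2) hg4
  have hneg : ∀ i, e (-i) = (e i)⁻¹ := fun i => by
    rw [eq_inv_iff_mul_eq_one, ← hadd, neg_add_cancel]
    simp [e]
  have hsub : ∀ i j, e (i - j) = e i * (e j)⁻¹ := fun i j => by rw [sub_eq_add_neg, hadd, hneg]
  have hcomm : ∀ i j, e i * e j = e j * e i := fun i j => by rw [← hadd, add_comm, hadd]
  have hinv : ∀ i, e i * b = b * (e i)⁻¹ := fun i => by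
    have h : SemiconjBy b g⁻¹ g := hgb.symm
    have h1 := h.pow_right i.val
    rw [inv_pow] at h1
    exact h1.eq.symm
  have h2 : e ((2 : ℕ) : ZMod (2 * 2)) = b * b := hb.symm
  let θ : QuaternionGroup 2 →* H := MonoidHom.mk'
    (fun x => match x with | a i => e i | xa i => b * e i) <| by
      rintro (i | i) (j | j)
      · exact hadd i j
      · change b * e (j - i) = e i * (b * e j)
        rw [hsub, ← mul_assoc (e i), hinv, mul_assoc, ← hneg, hcomm]
      · change b * e (i + j) = b * e i * e j
        rw [hadd, mul_assoc]
      · change e (((2 : ℕ) : ZMod (2 * 2)) + j - i) = b * e i * (b * e j)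
        rw [hsub, hadd, h2, mul_assoc, mul_assoc, mul_assoc, ← mul_assoc (e i), hinv, mul_assoc b,
          ← hneg, hcomm]
  have hinj : Function.Injective θ := by
    rw [injective_iff_map_eq_one]
    rintro (i | i) hi
    · change g ^ i.val = 1 at hi
      have := orderOf_dvd_of_pow_eq_one hi
      rw [hg] at this
      rw [(ZMod.val_eq_zero i).1 (Nat.eq_zero_of_dvd_of_lt this (ZMod.val_lt i))]
      rfl
    · change b * g ^ i.val = 1 at hi
      have hbi : b = (g ^ i.val)⁻¹ := eq_inv_of_mul_eq_one_left hi
      have hc : Commute g b := by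
        rw [hbi]
        exact ((Commute.refl g).pow_right _).inv_right
      rw [hc.eq] at hgb
      exact absurd (mul_left_cancel hgb) hne
  have : Finite H := Nat.finite_of_card_ne_zero (by rw [hcard]; norm_num)
  have hbij : Function.Bijective θ := (Nat.bijective_iff_injective_and_card θ).2
    ⟨hinj, by rw [hcard, Nat.card_eq_fintype_card, QuaternionGroup.card]⟩
  exact ⟨(MulEquiv.ofBijective θ hbij).symm⟩

/-- Extraspecial groups of order 8. -/
theorem nonempty_equiv_of_card_eight {H : Type*} [Group H] (hH : IsExtraspecial 2 H)
    (hcard : Nat.card H = 8) :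
    Nonempty (H ≃* ExtraspecialE1 2) ∨ Nonempty (H ≃* QuaternionGroup 2) := by
  have main : ∀ g b : H, ¬ Commute g b → g ^ 2 ≠ 1 →
      Nonempty (H ≃* ExtraspecialE1 2) ∨ Nonempty (H ≃* QuaternionGroup 2) := by
    intro g b hgb hg
    have hz := hH.pow_mem_center g
    -- The centre has order 2, so `g²` is its only nontrivial element; hence `[g, b] = g²`, i.e. `b`
    -- inverts `g`.
    have huniq : ∀ w ∈ Subgroup.center H, w ≠ 1 → w = g ^ 2 := by
      intro w hw hw1
      obtain ⟨n, hn⟩ := hH.exists_pow_eq Nat.prime_two hz hg hw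
      have h2 := hH.pow_eq_one hz
      rw [pow_eq_pow_mod n h2] at hn
      rcases Nat.mod_two_eq_zero_or_one n with h | h
      · rw [h, pow_zero] at hn
        exact absurd hn.symm hw1
      · rw [h, pow_one] at hn
        exact hn.symm
    have hc := huniq _ (hH.commutator_mem g b)
      (fun h0 => hgb (commutatorElement_eq_one_iff_commute.1 h0))
    have hg4 : g ^ 4 = 1 := by
      rw [show 4 = 2 * 2 from rfl, pow_mul]
      exact hH.pow_eq_one hz
    have hrel : g * b = b * g⁻¹ := by
      have h1 : g * b = g ^ 2 * (b * g) := by rw [← hc, commutatorElement_def]; group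
      rw [h1, (commute_of_mem_center hz _).eq, mul_assoc, ← pow_succ', mul_right_inj,
        eq_inv_iff_mul_eq_one, ← pow_succ, hg4]
    by_cases hb : b ^ 2 = 1
    · left
      -- As `b` is an involution inverting `g`, the elements `gb` and `b` are noncommuting
      -- involutions.
      refine hH.nonempty_equiv_extraspecialE1 Nat.prime_two hcard (a := g * b) (b := b) ?_ hb ?_
      · rw [sq]
        nth_rw 1 [hrel]
        rw [mul_assoc, inv_mul_cancel_left, ← sq, hb]
      · intro h
        refine hgb ?_
        have := h.eq
        rw [← mul_assoc] at this
        exact mul_right_cancel this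
    · right
      refine nonempty_equiv_quaternion hcard (g := g) (b := b) ?_ ?_ hrel ?_
      · exact orderOf_eq_prime_pow (p := 2) (n := 1) (by simpa using hg) hg4
      · rw [← sq]
        exact huniq _ (hH.pow_mem_center b) hb
      · intro h
        exact hg (by rw [sq, mul_eq_one_iff_eq_inv]; exact h)
  obtain ⟨x, y, hxy⟩ := hH.exists_not_commute Nat.prime_two
  by_cases hx : x ^ 2 = 1
  · by_cases hy : y ^ 2 = 1
    · exact .inl (hH.nonempty_equiv_extraspecialE1 Nat.prime_two hcard hx hy hxy)
    · exact main y x (fun h => hxy h.symm) hy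
  · exact main x y hxy hx

/-! ### Assembling the generic extraspecial case. -/

theorem tensorDegree_of_not_exceptional (hp : p.Prime) (hH : IsExtraspecial p H) {m : ℕ}
    (hm : 1 ≤ m) (hcard : Nat.card H = p ^ (2 * m + 1))
    (hE : IsEmpty (H ≃* ExtraspecialE1 p)) (hQ : IsEmpty (H ≃* QuaternionGroup 2)) :
    tensorDegree H = (2 * (p : ℚ) ^ (2 * m) - 1) / (p : ℚ) ^ (4 * m) := by
  refine hH.tensorDegree_eq hp hcard ?_
  rcases hm.eq_or_lt with rfl | hm
  · by_cases h2 : p = 2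
    · subst h2
      rcases hH.nonempty_equiv_of_card_eight hcard with h | h
      · exact (not_isEmpty_iff.2 h hE).elim
      · exact (not_isEmpty_iff.2 h hQ).elim
    · by_cases hexp : ∀ g : H, g ^ p = 1
      · obtain ⟨a, b, hab⟩ := hH.exists_not_commute hp
        exact (not_isEmpty_iff.2
          (hH.nonempty_equiv_extraspecialE1 hp hcard (hexp a) (hexp b) hab) hE).elim
      · push Not at hexp
        obtain ⟨g, hg⟩ := hexp
        exact hH.tmul_center_of_pow_ne_one hp h2 hg
  · refine hH.tmul_center_of_lt_card hp ?_
    rw [hcard]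
    exact Nat.pow_lt_pow_right hp.one_lt (by omega)

end IsExtraspecial

end TensorDegree

theorem theorem4p3 :
    (∀ n : ℕ, 3 < n →
      TensorDegree.tensorDegree (QuaternionGroup (2 ^ (n - 2))) =
        ((2 : ℚ) ^ (n - 3) + 2 ^ (n - 4) + 1) / 2 ^ n) ∧
    TensorDegree.tensorDegree (QuaternionGroup 2) = 1 / 4 ∧
    (∀ n : ℕ, 3 < n →
      TensorDegree.tensorDegree (DihedralGroup (2 ^ (n - 1))) =
        ((2 : ℚ) ^ (n - 3) + 2 ^ (n - 4) + 1) / 2 ^ n) ∧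
    TensorDegree.tensorDegree (DihedralGroup 4) = 5 / 16 ∧
    (∀ p : ℕ, p.Prime → p ≠ 2 →
      TensorDegree.tensorDegree (TensorDegree.ExtraspecialE1 p) =
        (2 * (p : ℚ) ^ 2 + p - 2) / (p : ℚ) ^ 5) ∧
    (∀ p : ℕ, p.Prime → ∀ m : ℕ, 1 ≤ m → ∀ (H : Type*) [Group H],
      TensorDegree.IsExtraspecial p H →
      Nat.card H = p ^ (2 * m + 1) →
      IsEmpty (H ≃* TensorDegree.ExtraspecialE1 p) →
      IsEmpty (H ≃* QuaternionGroup 2) →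
      IsEmpty (H ≃* DihedralGroup 4) →
      TensorDegree.tensorDegree H =
        (2 * (p : ℚ) ^ (2 * m) - 1) / (p : ℚ) ^ (4 * m)) :=
  ⟨TensorDegree.tensorDegree_quaternion, TensorDegree.tensorDegree_quaternion_two,
    TensorDegree.tensorDegree_dihedral, TensorDegree.tensorDegree_dihedral_four,
    TensorDegree.tensorDegree_extraspecialE1,
    fun _ hp _ hm _ _ hH hcard hE hQ _ => hH.tensorDegree_of_not_exceptional hp hm hcard hE hQ⟩
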